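/- Let $p$ be a prime and $n\ge 0$ an integer. Let $K$ be a local field of characteristic $p$, i.e. a complete discretely valued field, with perfect residue field, and let $L/K$ be a Galois extension of degree $p^n$ with group $G$ which is totally ramified and weakly ramified, the latter meaning that the second ramification group $G_2=\{\sigma\in G:(\sigma-1)\mathfrak{O}_L\subseteq\mathfrak{P}_L^{3}\}$ is trivial. Here $\mathfrak{O}_K,\mathfrak{O}_L$ are the valuation rings and $\mathfrak{P}_L$ is the maximal ideal of $\mathfrak{O}_L$. For $h\in\mathbb{Z}$ let $\mathfrak{A}=\{\alpha\in K[G]:\alpha\cdot\mathfrak{P}_L^h\subseteq\mathfrak{P}_L^h\}$ be the associated order of the fractional ideal $\mathfrak{P}_L^h$. For an integer $0<s<p^n$ write $s=\sum_{j=0}^{n-1}s_{(j)}p^j$ with $0\le s_{(j)}\le p-1$, let $v_p(s)$ be the exponent of $p$ in $s$, and put $$\alpha(s)=\bigl|\{j: 1\le j\le n-1,\ j>v_p(s),\ s_{(j)}\ne p-1\}\bigr|,$$ $$\beta(s)=\max\{c: 0\le c<n-v_p(s),\ s_{(n-1)}=\dots=s_{(n-c)}=(p-1)/2\},$$ and $\gamma(s)=1$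 if $p=2$ and $s=2^{n-1}$, $\gamma(s)=0$ otherwise. Then $\mathfrak{A}$ is a (not necessarily commutative) local ring; its embedding dimension is the dimension of $\mathfrak{M}/\mathfrak{M}^2$ over the residue ring $\mathfrak{A}/\mathfrak{M}$, where $\mathfrak{M}$ is the maximal ideal of $\mathfrak{A}$. Moreover: (i) If $h\equiv 1\bmod p^n$, then $\mathfrak{P}_L^h$ is free over $\mathfrak{A}$, and $\mathfrak{A}$ has embedding dimension $n+1$. (ii) If $h\not\equiv 1\bmod p^n$, let $h'\equiv h\bmod p^n$ with $2\le h'\le p^n$, and write $m=h'-1$ and $k=\max(m,p^n-m)$. Then (a) $\mathfrak{P}_L^h$ is free over $\mathfrak{A}$ if and only if $h'\ge 1+\tfrac12 p^n$; (b) if $\mathfrak{P}_L^h$ is not free over $\mathfrak{A}$, the minimal number of generators of $\mathfrak{P}_L^h$ as an $\mathfrak{A}$-module is $2+\alpha(m)-\beta(m)$; (c) the embedding dimension of $\mathfrak{A}$ is $n+2+\alpha(k)-\gamma(k)$. -/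

import Mathlib

open IsLocalRing
open scoped nonZeroDivisors

namespace WeakRam

/-! ### Base-`p` digit statistics -/

/-- The coefficient of `p ^ j` in the base-`p` expansion of `s`. -/
def digit (p s j : ℕ) : ℕ := s / p ^ j % p

/-- The number of `j` with `1 ≤ j ≤ n - 1`, `j > v_p(s)` and `j`-th base-`p` digit of `s`
different from `p - 1`. -/
def alphaStat (p n s : ℕ) : ℕ :=
  ((Finset.range n).filter
    (fun j => 1 ≤ j ∧ padicValNat p s < j ∧ digit p s j ≠ p - 1)).card

/-- The largest `c` with `0 ≤ c < n - v_p(s)` such that the `c` leading digits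
`s_(n-1), …, s_(n-c)` are all equal to the rational number `(p - 1) / 2`
(so this is `0` for `p = 2`). -/
def betaStat (p n s : ℕ) : ℕ :=
  ((Finset.range (n - padicValNat p s)).filter
    (fun c => ∀ i : ℕ, i < c → 2 * digit p s (n - 1 - i) = p - 1)).sup id

/-- `1` if `p = 2` and `s = 2 ^ (n - 1)`, and `0` otherwise. -/
def gammaStat (p n s : ℕ) : ℕ := if p = 2 ∧ s = 2 ^ (n - 1) then 1 else 0

/-! ### Ramification

`OK`, `OL` are the valuation rings of the local fields `K`, `L`. -/

section Ramification

variable (OK K OL L : Type*) [CommRing OK] [IsDomain OK] [IsDiscreteValuationRing OK]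
  [Field K] [Algebra OK K] [IsFractionRing OK K]
  [CommRing OL] [IsDomain OL] [IsDiscreteValuationRing OL]
  [Field L] [Algebra OL L] [IsFractionRing OL L]
  [Algebra K L] [Algebra OK L] [IsScalarTower OK K L] [FiniteDimensional K L]
  [Algebra OK OL] [IsScalarTower OK OL L] [IsIntegralClosure OL OK L]

/-- `L/K` is totally ramified: `𝔓_K O_L = 𝔓_L ^ [L : K]`, i.e. the ramification index is the
degree. -/
def IsTotallyRamified : Prop :=
  (maximalIdeal OK).map (algebraMap OK OL) = maximalIdeal OL ^ Module.finrank K L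

/-- The `j`-th ramification group in the lower numbering,
`G_j = {σ ∈ Gal(L/K) : (σ - 1) O_L ⊆ 𝔓_L ^ (j + 1)}`. -/
noncomputable def ramificationGroup (j : ℕ) : Subgroup (L ≃ₐ[K] L) :=
  ((maximalIdeal OL ^ (j + 1)).toAddSubgroup.inertia (OL ≃ₐ[OK] OL)).comap
    (galRestrict OK K L OL).toMonoidHom

set_option linter.unusedSectionVars false in
/-- Membership in `G_j`, read in `L`. -/
theorem mem_ramificationGroup (j : ℕ) (σ : L ≃ₐ[K] L) :
    σ ∈ ramificationGroup OK K OL L j ↔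
      ∀ x : OL, ∃ y ∈ maximalIdeal OL ^ (j + 1),
        algebraMap OL L y = σ (algebraMap OL L x) - algebraMap OL L x := by
  have key : ∀ x : OL, algebraMap OL L (galRestrict OK K L OL σ x - x) =
      σ (algebraMap OL L x) - algebraMap OL L x := by
    intro x
    rw [map_sub, algebraMap_galRestrict_apply]
  constructor
  · intro h x
    exact ⟨_, h x, key x⟩
  · intro h x
    obtain ⟨y, hy, hxy⟩ := h x
    have : y = galRestrict OK K L OL σ x - x :=
      IsFractionRing.injective OL L (hxy.trans (key x).symm)
    exact this ▸ hy

/-- `L/K` is weakly ramified: its second ramification group is trivial. -/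
def IsWeaklyRamified : Prop := ramificationGroup OK K OL L 2 = ⊥

/-- The fractional ideal `𝔓_L ^ h`, for `h ∈ ℤ`, as an `O_K`-submodule of `L`. -/
noncomputable def idealPow (h : ℤ) : Submodule OK L :=
  Submodule.restrictScalars OK
    (((maximalIdeal OL : FractionalIdeal OL⁰ L) ^ h : FractionalIdeal OL⁰ L) : Submodule OL L)

end Ramification

/-! ### Associated orders -/

section AssociatedOrder

variable (OK K L : Type*) [CommRing OK] [Field K] [Algebra OK K] [Field L] [Algebra K L]
  [Algebra OK L] [IsScalarTower OK K L]

/-- The usual `K`-linear action of the group algebra `K[Gal(L/K)]` on `L`,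
`(∑ a_σ σ) · x = ∑ a_σ σ(x)`. -/
noncomputable def groupAlgebraAction :
    MonoidAlgebra K (L ≃ₐ[K] L) →ₐ[K] Module.End K L :=
  MonoidAlgebra.lift K (Module.End K L) (L ≃ₐ[K] L) (DistribMulAction.toModuleEnd K L)

theorem groupAlgebraAction_single (σ : L ≃ₐ[K] L) (a : K) (x : L) :
    groupAlgebraAction K L (MonoidAlgebra.single σ a) x = a • σ x := by
  simp [groupAlgebraAction]

/-- The associated order `{α ∈ K[G] : α · P ⊆ P}` of an `O_K`-submodule `P` of `L`. -/
noncomputable def associatedOrder (P : Submodule OK L) :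
    Subalgebra OK (MonoidAlgebra K (L ≃ₐ[K] L)) where
  carrier := {α | ∀ x ∈ P, groupAlgebraAction K L α x ∈ P}
  mul_mem' := by
    intro a b ha hb x hx
    rw [map_mul]
    exact ha _ (hb x hx)
  add_mem' := by
    intro a b ha hb x hx
    rw [map_add]
    exact P.add_mem (ha x hx) (hb x hx)
  algebraMap_mem' := by
    intro r x hx
    have : groupAlgebraAction K L (algebraMap OK (MonoidAlgebra K (L ≃ₐ[K] L)) r) x = r • x := by
      rw [IsScalarTower.algebraMap_apply OK K (MonoidAlgebra K (L ≃ₐ[K] L)), AlgHom.commutes,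
        Module.algebraMap_end_apply, algebraMap_smul]
    rw [this]
    exact P.smul_mem r hx

/-- `P` is a module over its associated order, through the action of `K[G]` on `L`. -/
noncomputable instance associatedOrder.module (P : Submodule OK L) :
    Module (associatedOrder OK K L P) P where
  smul α x := ⟨groupAlgebraAction K L α.1 x.1, α.2 x.1 x.2⟩
  one_smul x := Subtype.ext <| by
    change groupAlgebraAction K L 1 x.1 = x.1
    rw [map_one]; rfl
  mul_smul a b x := Subtype.ext <| by
    change groupAlgebraAction K L (a.1 * b.1) x.1 = _
    rw [map_mul]; rfl
  smul_zero a := Subtype.ext <| map_zero (groupAlgebraAction K L a.1)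
  smul_add a x y := Subtype.ext <| map_add (groupAlgebraAction K L a.1) x.1 y.1
  add_smul a b x := Subtype.ext <| by
    change groupAlgebraAction K L (a.1 + b.1) x.1 = _
    rw [map_add]; rfl
  zero_smul x := Subtype.ext <| by
    change groupAlgebraAction K L 0 x.1 = 0
    rw [map_zero]; rfl

theorem associatedOrder.coe_smul (P : Submodule OK L) (α : associatedOrder OK K L P) (x : P) :
    ((α • x : P) : L) = groupAlgebraAction K L α.1 x.1 := rfl

end AssociatedOrder

/-! ### Minimal number of generators and embedding dimension -/

/-- `d` is the minimal number of generators of the `R`-module `M`. -/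
def IsMinGenerators (R M : Type*) [Ring R] [AddCommGroup M] [Module R M] (d : ℕ) : Prop :=
  IsLeast {c : ℕ | ∃ S : Finset M, S.card = c ∧ Submodule.span R (S : Set M) = ⊤} d

/-- The embedding dimension `dim (𝔐/𝔐²)`, over the residue ring `R/𝔐`, of a (not necessarily
commutative) local ring `R` with maximal ideal `𝔐`, the Jacobson radical of `R`. Here `𝔐²` appears
as the submodule `𝔐 • ⊤` of the `R`-module `𝔐`. -/
noncomputable def embDim (R : Type*) [Ring R] : ℕ :=
  Module.finrank (R ⧸ Ring.jacobson R)
    (Ring.jacobson R ⧸ (Ring.jacobson R • (⊤ : Submodule R (Ring.jacobson R))))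

end WeakRam

/-!
Write `N = p ^ n`, let `v` be the normalized valuation of `L`, and let `m` be the residue of `h - 1`
modulo `N`. The key point is that `L = K(y)` for some `y` with `v(y) = -1` which `G` moves by
translations `y ↦ y + α σ` with distinct `α σ ∈ K` (`WeakRam.IsTotWeak.exists_translation`). To find
it, start from the inverse `z` of a uniformizer. Weak ramification makes `σ z - z` a unit for every
`σ ≠ 1`, and the residue classes of these units embed `G` in the additive group of the residue
field. Lifting them additively to `α : G → K`, the additive form of Hilbert 90 gives an element of
`L` translated by `α`; its difference from `z` is fixed by `G` modulo `𝔓`, hence lies in `K + 𝔓`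
(`WeakRam.IsTotWeak.exists_sub_base_lt`, the vanishing of `H¹(G, 𝔓)`), so that subtracting an
element of `K` makes the valuation `-1`.

In terms of `y` the group algebra looks like a ring of divided powers. Expanding `(y + α σ) ^ a` and
inverting the Vandermonde matrix of the `α σ` gives a `K`-basis `D_s`, `0 ≤ s < N`, of `K[G]` acting
as Hasse derivatives, `D_s y ^ a = choose a s * y ^ (a - s)`, so that
`D_s D_r = choose (s + r) s * D_(s+r)`. Since the valuations of the `y ^ a` are distinct modulo `N`,
the ideal `𝔓 ^ h` has an `O_K`-basis of multiples of the `y ^ a` by powers of a uniformizer `t` of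
`K`, and a comparison of exponents shows that its associated order has the basis
`E_s = t ^ (-w s) D_s`, where `w s` is `1` if `max m (N - m) ≤ s` and `0` otherwise
(`WeakRam.exists_bases`).

An order `𝔄` with such a basis is local, its maximal ideal `𝔐` being spanned by `t` and the `E_s`
with `s > 0`. Modulo `𝔐 ^ 2` only `t` and those `E_s` survive that are not a unit times a product
`E_a E_b` with `a, b > 0`; in the same way `𝔓 ^ h` is minimally generated by those basis elements to
which no `E_s` with `s > 0` takes another one, up to a unit. As `𝔄` and `𝔓 ^ h` have the same rank
over `O_K`, freeness means that one generator suffices. Both counts depend only on which binomial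
coefficients are prime to `p` and on where the weights jump, and Lucas' theorem turns them into the
digit statistics `α`, `β`, `γ` (`WeakRam.card_indecomposables`, `WeakRam.card_generatingExponents`).
-/

namespace WeakRam

/-! ### Binomial coefficients modulo a prime -/

section Binomial

variable {p : ℕ}

theorem pow_padicValNat_le {s : ℕ} (hs : s ≠ 0) : p ^ padicValNat p s ≤ s :=
  Nat.le_of_dvd (Nat.pos_of_ne_zero hs) pow_padicValNat_dvd

variable [hp : Fact p.Prime]

theorem pow_dvd_of_not_dvd_choose {j s r : ℕ} (hs : p ^ j ∣ s) (h : ¬ p ∣ s.choose r) :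
    p ^ j ∣ r := by
  rcases r with _ | r
  · exact dvd_zero _
  rcases s with _ | s
  · simp at h
  have h1 : p ^ j ∣ (s + 1).choose (r + 1) * (r + 1) := by
    rw [← Nat.add_one_mul_choose_eq]
    exact hs.mul_right _
  exact (((hp.out.coprime_iff_not_dvd).2 h).pow_left j).dvd_of_dvd_mul_left h1

theorem pow_dvd_of_not_dvd_choose_add {j b s : ℕ} (hb : p ^ j ∣ b + 1)
    (h : ¬ p ∣ (b + s).choose s) : p ^ j ∣ s := by
  have h1 : (b + s).choose (b + 1) * (b + 1) = (b + s).choose s * s := by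
    rw [Nat.choose_succ_right_eq, Nat.add_sub_cancel_left, ← Nat.choose_symm_add]
  have h2 : p ^ j ∣ (b + s).choose s * s := h1 ▸ hb.mul_left _
  exact (((hp.out.coprime_iff_not_dvd).2 h).pow_left j).dvd_of_dvd_mul_left h2

/-- Lucas' theorem for a power of `p` below. -/
theorem choose_pow_modEq (x j : ℕ) : (x.choose (p ^ j) : ℤ) ≡ (x / p ^ j : ℕ) [ZMOD p] := by
  have h := Choose.choose_modEq_choose_mul_prod_range_choose (p := p) (n := x) (k := p ^ j) j
  rw [Nat.div_self (pow_pos hp.out.pos j), Nat.choose_one_right, Finset.prod_eq_one,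
    Nat.cast_one, mul_one] at h
  · exact h
  · intro i hi
    rw [Finset.mem_range] at hi
    have : p ^ j / p ^ i % p = 0 := by
      rw [Nat.pow_div hi.le hp.out.pos]
      exact Nat.mod_eq_zero_of_dvd (dvd_pow_self p (by omega))
    simp [this]

theorem not_dvd_choose_pow {x j : ℕ} (h : ¬ p ∣ x / p ^ j) : ¬ p ∣ x.choose (p ^ j) := by
  intro h'
  apply h
  have h1 := choose_pow_modEq (p := p) x j
  rw [← Int.natCast_dvd_natCast] at h' ⊢
  exact (Int.ModEq.dvd_iff h1).1 h'

theorem not_dvd_choose_pow_sub_one {n s : ℕ} (hs : s < p ^ n) :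
    ¬ p ∣ (p ^ n - 1).choose s := by
  induction s with
  | zero => simpa using hp.out.one_lt.ne'
  | succ s ih =>
    intro h
    refine ih (by omega) ?_
    have h1 : (p ^ n).choose (s + 1) = (p ^ n - 1).choose s + (p ^ n - 1).choose (s + 1) := by
      obtain ⟨N, hN⟩ : ∃ N, p ^ n = N + 1 := ⟨p ^ n - 1, by omega⟩
      rw [hN, Nat.add_sub_cancel, Nat.choose_succ_succ']
    have h2 : p ∣ (p ^ n).choose (s + 1) := hp.out.dvd_choose_pow (by omega) (by omega)
    rw [h1] at h2
    exact (Nat.dvd_add_left h).1 h2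

/-- A positive integer as `p ^ v * c` with `v` its `p`-adic valuation and `c` prime to `p`. -/
theorem eq_pow_padicValNat_mul {s : ℕ} (hs : s ≠ 0) :
    ∃ c, s = p ^ padicValNat p s * c ∧ ¬ p ∣ c := by
  obtain ⟨c, hc⟩ := pow_padicValNat_dvd (p := p) (n := s)
  refine ⟨c, hc, fun ⟨e, he⟩ => pow_succ_padicValNat_not_dvd (p := p) hs ⟨e, ?_⟩⟩
  rw [pow_succ, mul_assoc, ← he]
  exact hc

theorem padicValNat_pow_mul {j c : ℕ} (hc : ¬ p ∣ c) : padicValNat p (p ^ j * c) = j := by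
  have hc0 : c ≠ 0 := by rintro rfl; simp at hc
  rw [padicValNat.mul (pow_ne_zero _ hp.out.ne_zero) hc0, padicValNat.prime_pow,
    padicValNat.eq_zero_of_not_dvd hc, add_zero]

theorem not_dvd_choose_pow_padicValNat {s : ℕ} (hs : s ≠ 0) :
    ¬ p ∣ s.choose (p ^ padicValNat p s) := by
  obtain ⟨c, hc, hpc⟩ := eq_pow_padicValNat_mul (p := p) hs
  refine not_dvd_choose_pow ?_
  rw [Nat.div_eq_of_eq_mul_right (pow_pos hp.out.pos _) hc]
  exact hpc

theorem not_dvd_choose_add_pow_padicValNat (b : ℕ) :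
    ¬ p ∣ (b + p ^ padicValNat p (b + 1)).choose (p ^ padicValNat p (b + 1)) := by
  obtain ⟨c, hc, hpc⟩ := eq_pow_padicValNat_mul (p := p) (Nat.succ_ne_zero b)
  generalize padicValNat p (b + 1) = v at *
  refine not_dvd_choose_pow ?_
  have hv : 0 < p ^ v := pow_pos hp.out.pos v
  have : b + p ^ v = (p ^ v - 1) + p ^ v * c := by omega
  rw [this, Nat.add_mul_div_left _ _ hv, Nat.div_eq_of_lt (by omega), zero_add]
  exact hpc

theorem add_pow_padicValNat_lt {n b : ℕ} (hb : b + 1 < p ^ n) :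
    b + p ^ padicValNat p (b + 1) < p ^ n := by
  obtain ⟨c, hc, -⟩ := eq_pow_padicValNat_mul (p := p) (Nat.succ_ne_zero b)
  have hle : p ^ padicValNat p (b + 1) ≤ b + 1 := pow_padicValNat_le (Nat.succ_ne_zero b)
  have hvn : padicValNat p (b + 1) < n :=
    (Nat.pow_lt_pow_iff_right hp.out.one_lt).1 (lt_of_le_of_lt hle hb)
  generalize padicValNat p (b + 1) = v at *
  obtain ⟨e, he⟩ := pow_dvd_pow p hvn.le
  rw [he] at hb ⊢
  have hv : 0 < p ^ v := pow_pos hp.out.pos v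
  have h1 : c < e := by
    rw [← Nat.succ_eq_add_one, hc] at hb
    exact lt_of_mul_lt_mul_left' hb
  have h2 : p ^ v * (c + 1) ≤ p ^ v * e := Nat.mul_le_mul_left _ h1
  rw [mul_add, ← hc] at h2
  omega

end Binomial

/-! ### Counting with base-`p` digits -/

section Counting

variable {p : ℕ}

/-- The admissible `c` in the definition of `betaStat` form an initial segment of `ℕ`. -/
theorem card_betaStat {n m : ℕ} (hv : padicValNat p m < n) :
    ((Finset.range (n - padicValNat p m)).filter
      (fun c => ∀ i : ℕ, i < c → 2 * digit p m (n - 1 - i) = p - 1)).card =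
      betaStat p n m + 1 := by
  unfold betaStat
  set B := (Finset.range (n - padicValNat p m)).filter
      (fun c => ∀ i : ℕ, i < c → 2 * digit p m (n - 1 - i) = p - 1) with hB
  have h0 : (0 : ℕ) ∈ B := by
    rw [hB, Finset.mem_filter, Finset.mem_range]
    exact ⟨by omega, by simp⟩
  have h1 : B = Finset.range (B.sup id + 1) := by
    ext c
    rw [Finset.mem_range, Nat.lt_succ_iff]
    refine ⟨fun h => Finset.le_sup (f := id) h, fun h => ?_⟩
    obtain ⟨b, hb, hb'⟩ := Finset.exists_mem_eq_sup B ⟨0, h0⟩ id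
    rw [hb'] at h
    simp only [hB, Finset.mem_filter, Finset.mem_range, id] at hb h ⊢
    exact ⟨by omega, fun i hi => hb.2 i (by omega)⟩
  conv_lhs => rw [h1, Finset.card_range]

variable [hp : Fact p.Prime]

/-- The `s` with `k ≤ s < p ^ n` that drop below `k` when their lowest nonzero base-`p` digit is
decreased by one. -/
def dropSet (p n k : ℕ) : Finset ℕ :=
  (Finset.range (p ^ n)).filter (fun s => k ≤ s ∧ s - p ^ padicValNat p s < k)

/-- The smallest multiple of `p ^ j` exceeding `k`. -/
def nextMultiple (p k j : ℕ) : ℕ := p ^ j * (k / p ^ j + 1)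

theorem padicValNat_nextMultiple {k j : ℕ} (hd : digit p k j ≠ p - 1) :
    padicValNat p (nextMultiple p k j) = j := by
  refine padicValNat_pow_mul fun h => hd ?_
  unfold digit
  obtain ⟨e, he⟩ := h
  have h1 : 0 < p := hp.out.pos
  rcases e with _ | e
  · simp at he
  · have : k / p ^ j = (p - 1) + p * e := by rw [mul_add] at he; omega
    rw [this, Nat.add_mul_mod_self_left, Nat.mod_eq_of_lt (by omega)]

theorem lt_nextMultiple (k j : ℕ) : k < nextMultiple p k j :=
  Nat.lt_mul_div_succ k (pow_pos hp.out.pos j)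

theorem nextMultiple_sub_lt {k j : ℕ} (hk : k ≠ 0) (hj : padicValNat p k < j) :
    nextMultiple p k j - p ^ j < k := by
  have h1 : nextMultiple p k j - p ^ j = p ^ j * (k / p ^ j) := by
    rw [nextMultiple, mul_add, mul_one, Nat.add_sub_cancel]
  rw [h1]
  refine lt_of_le_of_ne (Nat.mul_div_le k _) fun h => ?_
  have := (padicValNat_dvd_iff_le (p := p) hk).1 ⟨_, h.symm⟩
  omega

theorem nextMultiple_lt {n k j : ℕ} (hk : k < p ^ n) (hj : j < n) (hd : digit p k j ≠ p - 1) :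
    nextMultiple p k j < p ^ n := by
  obtain ⟨e, he⟩ : ∃ e, n = j + e + 1 := ⟨n - j - 1, by omega⟩
  subst he
  have hpj : 0 < p ^ j := pow_pos hp.out.pos j
  have h1 : k / p ^ j < p ^ (e + 1) := by
    rw [Nat.div_lt_iff_lt_mul hpj, ← pow_add]
    convert hk using 2; ring
  have h2 : nextMultiple p k j ≤ p ^ (j + e + 1) := by
    rw [add_assoc, pow_add]
    exact Nat.mul_le_mul_left _ h1
  refine lt_of_le_of_ne h2 fun h => ?_
  have h3 := padicValNat_nextMultiple (p := p) hd
  rw [h, padicValNat.prime_pow] at h3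
  omega

/-- An `s > k` in `dropSet p n k` with `p`-adic valuation `j` is the smallest multiple of `p ^ j`
exceeding `k`; that multiple has valuation exactly `j` when the `j`-th digit of `k` is not `p - 1`,
and `v_p(k) < j` says that the multiple before it is not `k` itself. -/
theorem mem_dropSet_iff {n k s : ℕ} (hk : k ≠ 0) (hkn : k < p ^ n) :
    s ∈ dropSet p n k ↔ s = k ∨ ∃ j, j < n ∧ padicValNat p k < j ∧ digit p k j ≠ p - 1 ∧
      s = nextMultiple p k j := by
  simp only [dropSet, Finset.mem_filter, Finset.mem_range]
  constructor
  · rintro ⟨hsN, hks, hs⟩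
    rcases eq_or_lt_of_le hks with rfl | hks
    · exact Or.inl rfl
    right
    have hs0 : s ≠ 0 := by omega
    obtain ⟨c, hc, hpc⟩ := eq_pow_padicValNat_mul (p := p) hs0
    have hle := pow_padicValNat_le (p := p) hs0
    have hjn : padicValNat p s < n :=
      (Nat.pow_lt_pow_iff_right hp.out.one_lt).1 (lt_of_le_of_lt hle hsN)
    generalize padicValNat p s = j at *
    have hpj : 0 < p ^ j := pow_pos hp.out.pos j
    obtain ⟨c, rfl⟩ : ∃ c', c = c' + 1 := ⟨c - 1, by
      rcases c with _ | c
      · simp at hpc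
      · rfl⟩
    have hdiv : k / p ^ j = c := by
      rw [mul_add, mul_one] at hc
      rw [Nat.div_eq_iff hpj]
      constructor
      · rw [mul_comm]; omega
      · rw [mul_comm c]; omega
    refine ⟨j, hjn, ?_, ?_, ?_⟩
    · by_contra hle'
      obtain ⟨e, he⟩ := (padicValNat_dvd_iff_le (p := p) hk).2 (not_lt.1 hle')
      have : e = c := by rw [← hdiv, he, Nat.mul_div_cancel_left _ hpj]
      subst this
      rw [mul_add, mul_one] at hc
      omega
    · unfold digit
      rw [hdiv]
      intro hd
      apply hpc
      have h1 := Nat.div_add_mod c p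
      rw [hd] at h1
      have h2 : 0 < p := hp.out.pos
      exact ⟨c / p + 1, by rw [mul_add]; omega⟩
    · rw [nextMultiple, hdiv, ← hc]
  · rintro (rfl | ⟨j, hjn, hj, hd, rfl⟩)
    · exact ⟨hkn, le_rfl, by have := pow_pos hp.out.pos (padicValNat p s); omega⟩
    · refine ⟨nextMultiple_lt hkn hjn hd, (lt_nextMultiple k j).le, ?_⟩
      rw [padicValNat_nextMultiple hd]
      exact nextMultiple_sub_lt hk hj

theorem card_dropSet {n k : ℕ} (hk : k ≠ 0) (hkn : k < p ^ n) :
    (dropSet p n k).card = 1 + alphaStat p n k := by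
  have h1 : dropSet p n k = insert k (((Finset.range n).filter
      (fun j => 1 ≤ j ∧ padicValNat p k < j ∧ digit p k j ≠ p - 1)).image
        (nextMultiple p k)) := by
    ext s
    rw [mem_dropSet_iff hk hkn]
    simp only [Finset.mem_insert, Finset.mem_image, Finset.mem_filter, Finset.mem_range]
    refine or_congr_right ⟨?_, ?_⟩
    · rintro ⟨j, a, b, c, d⟩
      exact ⟨j, ⟨a, by omega, b, c⟩, d.symm⟩
    · rintro ⟨j, ⟨a, -, b, c⟩, d⟩
      exact ⟨j, a, b, c, d.symm⟩
  rw [h1, Finset.card_insert_of_notMem, Finset.card_image_of_injOn, alphaStat, add_comm]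
  · intro i hi j hj hij
    simp only [Finset.coe_filter, Set.mem_ofPred_eq] at hi hj
    have := congrArg (padicValNat p) hij
    rwa [padicValNat_nextMultiple hi.2.2.2, padicValNat_nextMultiple hj.2.2.2] at this
  · intro h
    obtain ⟨j, -, hj⟩ := Finset.mem_image.1 h
    exact (lt_nextMultiple (p := p) k j).ne' hj

/-- The `c` leading digits of `m` are all `(p - 1) / 2` exactly when the number they form is
`(p ^ c - 1) / 2`. -/
theorem leading_digits_iff {n m : ℕ} (hm : m < p ^ n) {c : ℕ} (hc : c ≤ n) :
    (∀ i < c, 2 * digit p m (n - 1 - i) = p - 1) ↔ 2 * (m / p ^ (n - c)) + 1 = p ^ c := by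
  induction c with
  | zero => simp [Nat.div_eq_of_lt hm]
  | succ c ih =>
    rw [Nat.forall_lt_succ_right, ih (by omega)]
    have h1 : n - 1 - c = n - (c + 1) := by omega
    have h2 : m / p ^ (n - c) = m / p ^ (n - (c + 1)) / p := by
      rw [Nat.div_div_eq_div_mul, ← pow_succ]
      congr 2; omega
    rw [digit, h1, h2]
    generalize m / p ^ (n - (c + 1)) = x
    have h3 := Nat.div_add_mod x p
    have h4 := Nat.mod_lt x hp.out.pos
    have h5 := hp.out.two_le
    generalize x / p = q at *
    generalize x % p = d at *
    subst h3
    have h6 : 2 * (p * q + d) + 1 = p * (2 * q) + (2 * d + 1) := by ring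
    rw [h6, pow_succ']
    constructor
    · rintro ⟨h, h'⟩
      rw [← h]
      have : 2 * d + 1 = p := by omega
      rw [this]; ring
    · intro h
      have h7 : p ∣ 2 * d + 1 := by
        refine (Nat.dvd_add_right (dvd_mul_right p (2 * q))).1 ?_
        rw [h]; exact dvd_mul_right _ _
      obtain ⟨e, he⟩ := h7
      have h8 : e = 1 := by
        rcases e with _ | _ | e
        · omega
        · rfl
        · exfalso
          have : p * (e + 1 + 1) = p * e + 2 * p := by ring
          omega
      subst h8
      rw [he, ← mul_add] at h
      exact ⟨Nat.eq_of_mul_eq_mul_left hp.out.pos h, by omega⟩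

/-- The elements of `dropSet p n m` not below `p ^ n - m` are the `nextMultiple p m (n - c)` for
which the `c ≥ 1` leading digits of `m` are all `(p - 1) / 2`. -/
theorem card_dropSet_filter_lt {n m : ℕ} (hm : m ≠ 0) (hmn : 2 * m < p ^ n) :
    (((dropSet p n m).filter (fun c => c < p ^ n - m)).card : ℤ) =
      1 + alphaStat p n m - betaStat p n m := by
  have hmN : m < p ^ n := by omega
  have hv : padicValNat p m < n :=
    (Nat.pow_lt_pow_iff_right hp.out.one_lt).1 (lt_of_le_of_lt (pow_padicValNat_le hm) hmN)
  have h1 : (dropSet p n m).filter (fun c => ¬ c < p ^ n - m) =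
      (((Finset.range (n - padicValNat p m)).filter
      (fun c => ∀ i : ℕ, i < c → 2 * digit p m (n - 1 - i) = p - 1)).erase 0).image
        (fun c => nextMultiple p m (n - c)) := by
    ext s
    rw [Finset.mem_filter, mem_dropSet_iff hm hmN]
    simp only [Finset.mem_image, Finset.mem_filter, Finset.mem_range, Finset.mem_erase]
    -- For `j > v_p(m)` the bound fails exactly when `2 * (m / p ^ j) + 1 = p ^ (n - j)`.
    have key : ∀ j, j < n → padicValNat p m < j →
        (¬ nextMultiple p m j < p ^ n - m ↔ 2 * (m / p ^ j) + 1 = p ^ (n - j)) := by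
      intro j hj hvj
      have hpj : 0 < p ^ j := pow_pos hp.out.pos j
      have hN : p ^ n = p ^ j * p ^ (n - j) := by rw [← pow_add]; congr 1; omega
      have hdm := Nat.div_add_mod m (p ^ j)
      have hmod := Nat.mod_lt m hpj
      have hpos : m % p ^ j ≠ 0 := fun h => by
        have := (padicValNat_dvd_iff_le (p := p) hm).1 (Nat.dvd_of_mod_eq_zero h)
        omega
      rw [nextMultiple]
      generalize m / p ^ j = q at *
      generalize m % p ^ j = r at *
      generalize p ^ (n - j) = E at *
      generalize p ^ j = P at *
      rw [hN] at hmn hmN ⊢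
      have e1 : P * (q + 1) = P * q + P := by ring
      have e2 : P * (2 * q + 1) = 2 * (P * q) + P := by ring
      have hlt : 2 * q < E := by
        by_contra hcon
        have h := Nat.mul_le_mul_left P (not_lt.1 hcon)
        rw [show P * (2 * q) = 2 * (P * q) by ring] at h
        omega
      rw [e1]
      constructor
      · intro h
        refine le_antisymm hlt ?_
        by_contra hcon
        have h' := Nat.mul_le_mul_left P (Nat.succ_le_of_lt (not_le.1 hcon))
        rw [Nat.succ_eq_add_one, mul_add, e2] at h'
        omega
      · intro h
        rw [← h, e2]
        omega
    constructor
    · rintro ⟨rfl | ⟨j, hj, hvj, hd, rfl⟩, hs⟩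
      · omega
      · refine ⟨n - j, ⟨by omega, by omega, ?_⟩, by congr 1; omega⟩
        rw [leading_digits_iff hmN (by omega), show n - (n - j) = j by omega]
        exact (key j hj hvj).1 hs
    · rintro ⟨c, ⟨hc0, hc, hdig⟩, rfl⟩
      have hd : digit p m (n - c) ≠ p - 1 := by
        have h := hdig (c - 1) (by omega)
        rw [show n - 1 - (c - 1) = n - c by omega] at h
        have := hp.out.two_le
        omega
      rw [leading_digits_iff hmN (by omega)] at hdig
      refine ⟨Or.inr ⟨n - c, by omega, by omega, hd, rfl⟩, ?_⟩
      rw [key (n - c) (by omega) (by omega), show n - (n - c) = c by omega]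
      exact hdig
  have h2 : ((dropSet p n m).filter (fun c => ¬ c < p ^ n - m)).card = betaStat p n m := by
    rw [h1, Finset.card_image_of_injOn, Finset.card_erase_of_mem, card_betaStat hv,
      Nat.add_sub_cancel]
    · rw [Finset.mem_filter, Finset.mem_range]
      exact ⟨by omega, by simp⟩
    · intro a ha b hb hab
      simp only [Finset.coe_erase, Set.mem_sdiff, Finset.coe_filter,
        Finset.mem_range, Set.mem_ofPred_eq, Set.mem_singleton_iff] at ha hb
      have hd : ∀ c, (c < n - padicValNat p m ∧ ∀ i < c, 2 * digit p m (n - 1 - i) = p - 1) ∧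
          ¬c = 0 → digit p m (n - c) ≠ p - 1 := by
        intro c hc
        have h := hc.1.2 (c - 1) (by omega)
        rw [show n - 1 - (c - 1) = n - c by omega] at h
        have := hp.out.two_le
        omega
      have := congrArg (padicValNat p) hab
      simp only at this
      rw [padicValNat_nextMultiple (hd a ha), padicValNat_nextMultiple (hd b hb)] at this
      omega
  have h3 := Finset.card_filter_add_card_filter_not (s := dropSet p n m) (fun c => c < p ^ n - m)
  rw [h2, card_dropSet hm hmN] at h3
  omega

end Counting

/-! ### Indecomposable exponents and generating exponents -/

open Classical in
/-- The positive exponents `s < N` that do not split as `r + (s - r)` with `p ∤ choose s r`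
without loss of weight. They index a basis of `𝔐 / (𝔐 ^ 2 + t)` for the ring with weight
function `w`. -/
noncomputable def indecomposables (p N : ℕ) (w : ℕ → ℕ) : Finset ℕ :=
  (Finset.range N).filter fun s => 0 < s ∧
    ∀ r, 0 < r → r < s → ¬ p ∣ s.choose r → w r + w (s - r) < w s

open Classical in
/-- The exponents `b < N` that are not reached, without loss of weight, from a larger exponent
`b + s` with `p ∤ choose (b + s) s`. They index a minimal system of generators of the module with
weight function `d` over the ring with weight function `w`. -/
noncomputable def generatingExponents (p N : ℕ) (w d : ℕ → ℕ) : Finset ℕ :=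
  (Finset.range N).filter fun b =>
    ∀ s, 0 < s → b + s < N → ¬ p ∣ (b + s).choose s → d b + w s < d (b + s)

theorem mem_indecomposables {p N s : ℕ} {w : ℕ → ℕ} : s ∈ indecomposables p N w ↔
    s < N ∧ 0 < s ∧ ∀ r, 0 < r → r < s → ¬ p ∣ s.choose r → w r + w (s - r) < w s := by
  classical
  rw [indecomposables, Finset.mem_filter, Finset.mem_range]

theorem mem_generatingExponents {p N b : ℕ} {w d : ℕ → ℕ} :
    b ∈ generatingExponents p N w d ↔ b < N ∧
      ∀ s, 0 < s → b + s < N → ¬ p ∣ (b + s).choose s → d b + w s < d (b + s) := by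
  classical
  rw [generatingExponents, Finset.mem_filter, Finset.mem_range]

/-- The weight function `0` below `k` and `1` from `k` on. -/
def stepWeight (k s : ℕ) : ℕ := if k ≤ s then 1 else 0

section Indecomposable

variable {p : ℕ} [hp : Fact p.Prime]

/-- By Lucas' theorem the most economical splitting takes `r` to be the largest power of `p`
dividing `s`. So below `k` only powers of `p` are indecomposable, and from `k` on those `s` for which
`s - r` drops below `k`; two parts below `k` then cost no weight, and `p ^ n ≤ 2 * k` prevents two
parts of weight `1`. -/
theorem mem_indecomposables_iff {n k s : ℕ} (hk : p ^ n ≤ 2 * k) (hk0 : 0 < k) :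
    s ∈ indecomposables p (p ^ n) (stepWeight k) ↔
      (∃ j, j < n ∧ p ^ j < k ∧ p ^ j = s) ∨ s ∈ dropSet p n k := by
  rw [mem_indecomposables]
  simp only [dropSet, Finset.mem_filter, Finset.mem_range]
  constructor
  · rintro ⟨hsN, hs0, hs⟩
    have hs0' : s ≠ 0 := hs0.ne'
    have hle := pow_padicValNat_le (p := p) hs0'
    have hpos := pow_pos hp.out.pos (padicValNat p s)
    have hlow := hs (p ^ padicValNat p s) hpos
    have hjn : padicValNat p s < n :=
      (Nat.pow_lt_pow_iff_right hp.out.one_lt).1 (lt_of_le_of_lt hle hsN)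
    rcases eq_or_lt_of_le hle with h | h
    · rcases lt_or_ge s k with hsk | hsk
      · exact Or.inl ⟨_, hjn, by omega, h⟩
      · exact Or.inr ⟨hsN, hsk, by omega⟩
    · have h1 := hlow h (not_dvd_choose_pow_padicValNat hs0')
      unfold stepWeight at h1
      refine Or.inr ⟨hsN, ?_, ?_⟩
      · by_contra h2; rw [if_neg h2] at h1; omega
      · by_contra h2; rw [if_pos (not_lt.1 h2)] at h1; split_ifs at h1 <;> omega
  · rintro (⟨j, hj, hjk, rfl⟩ | ⟨hsN, hks, hs⟩)
    · refine ⟨Nat.pow_lt_pow_right hp.out.one_lt hj, pow_pos hp.out.pos j, fun r h0 h1 h2 => ?_⟩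
      exact absurd (hp.out.dvd_choose_pow h0.ne' h1.ne) h2
    · refine ⟨hsN, by omega, fun r h0 h1 h2 => ?_⟩
      have h3 : ∀ r, 0 < r → r < s → ¬ p ∣ s.choose r → r < k := by
        intro r h0 h1 h2
        have h3 := pow_dvd_of_not_dvd_choose (p := p) pow_padicValNat_dvd h2
        have h4 := Nat.le_of_dvd (by omega) (Nat.dvd_sub (pow_padicValNat_dvd (p := p) (n := s)) h3)
        omega
      have h4 := h3 r h0 h1 h2
      have h5 := h3 (s - r) (by omega) (by omega) (by rwa [Nat.choose_symm h1.le])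
      unfold stepWeight
      rw [if_neg (by omega), if_neg (by omega), if_pos hks]
      norm_num

theorem card_indecomposables {n k : ℕ} (hk : p ^ n ≤ 2 * k) (hkn : k < p ^ n) :
    ((indecomposables p (p ^ n) (stepWeight k)).card : ℤ) =
      n + 1 + alphaStat p n k - gammaStat p n k := by
  have hk0 : 0 < k := by have := pow_pos hp.out.pos n; omega
  have hn : n ≠ 0 := by rintro rfl; rw [pow_zero] at hkn hk; omega
  have h1 : indecomposables p (p ^ n) (stepWeight k) =
      (((Finset.range n).filter (fun j => p ^ j < k)).image (p ^ ·)) ∪ dropSet p n k := by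
    ext s
    rw [mem_indecomposables_iff hk hk0]
    simp only [Finset.mem_union, Finset.mem_image, Finset.mem_filter, Finset.mem_range, and_assoc]
  have h2 : ((Finset.range n).filter (fun j => p ^ j < k)).card + gammaStat p n k = n := by
    have hN : p ^ n = p * p ^ (n - 1) := by rw [← pow_succ']; congr 1; omega
    have hlow : ∀ j, j < n → p ^ j ≤ p ^ (n - 1) := fun j hj =>
      Nat.pow_le_pow_right hp.out.pos (by omega)
    have hp2 := hp.out.two_le
    have hmul := Nat.mul_le_mul_right (p ^ (n - 1)) hp2
    unfold gammaStat
    split_ifs with hg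
    · have : (Finset.range n).filter (fun j => p ^ j < k) = Finset.range (n - 1) := by
        ext j
        rw [Finset.mem_filter, Finset.mem_range, Finset.mem_range, hg.2, ← hg.1,
          Nat.pow_lt_pow_iff_right hp.out.one_lt]
        omega
      rw [this, Finset.card_range]
      omega
    · rw [Finset.filter_true_of_mem, Finset.card_range, add_zero]
      intro j hj
      have h3 := hlow j (Finset.mem_range.1 hj)
      by_contra hcon
      have h4 : p = 2 := by
        by_contra h5
        have h6 : 3 ≤ p := by omega
        have := Nat.mul_le_mul_right (p ^ (n - 1)) h6
        have := pow_pos hp.out.pos (n - 1)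
        omega
      subst h4
      exact hg ⟨rfl, by omega⟩
  rw [h1, Finset.card_union_of_disjoint, Finset.card_image_of_injective _
    (Nat.pow_right_injective hp.out.two_le), card_dropSet hk0.ne' hkn]
  · omega
  · rw [Finset.disjoint_left]
    intro s hs hs'
    obtain ⟨j, hj, rfl⟩ := Finset.mem_image.1 hs
    rw [Finset.mem_filter] at hj
    rw [dropSet, Finset.mem_filter] at hs'
    omega

/-- For the zero weight the indecomposable exponents are the powers of `p`. -/
theorem card_indecomposables_self (n : ℕ) :
    (indecomposables p (p ^ n) (stepWeight (p ^ n))).card = n := by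
  have h0 := pow_pos hp.out.pos n
  have h1 : indecomposables p (p ^ n) (stepWeight (p ^ n)) = (Finset.range n).image (p ^ ·) := by
    ext s
    rw [mem_indecomposables_iff (by omega) h0]
    simp only [Finset.mem_image, Finset.mem_range, dropSet, Finset.mem_filter]
    constructor
    · rintro (⟨j, hj, -, rfl⟩ | ⟨h, h', -⟩)
      · exact ⟨j, hj, rfl⟩
      · omega
    · rintro ⟨j, hj, rfl⟩
      exact Or.inl ⟨j, hj, Nat.pow_lt_pow_right hp.out.one_lt hj, rfl⟩
  rw [h1, Finset.card_image_of_injective _ (Nat.pow_right_injective hp.out.two_le),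
    Finset.card_range]

end Indecomposable

section Generating

variable {p : ℕ} [hp : Fact p.Prime]

/-- The exponent `b` can be tested against the nearest larger exponent with nonzero binomial
coefficient, `b + p ^ v_p(b + 1)`, and against the farthest one, `p ^ n - 1`. -/
theorem mem_generatingExponents_iff {n m b : ℕ} (hm : m < p ^ n) :
    b ∈ generatingExponents p (p ^ n) (stepWeight (max m (p ^ n - m)))
        (stepWeight (p ^ n - m)) ↔
      b = p ^ n - 1 ∨ (b + 1 < p ^ n ∧ b < p ^ n - m ∧ p ^ n - 1 - b < max m (p ^ n - m) ∧
        p ^ n - m ≤ b + p ^ padicValNat p (b + 1)) := by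
  have hpos := pow_pos hp.out.pos (padicValNat p (b + 1))
  rw [mem_generatingExponents]
  unfold stepWeight
  constructor
  · rintro ⟨hbN, hb⟩
    rcases eq_or_ne b (p ^ n - 1) with h | h
    · exact Or.inl h
    have hbN' : b + 1 < p ^ n := by omega
    have h1 := hb _ hpos (add_pow_padicValNat_lt hbN') (not_dvd_choose_add_pow_padicValNat b)
    have h2 := hb (p ^ n - 1 - b) (by omega) (by omega) (by
      rw [show b + (p ^ n - 1 - b) = p ^ n - 1 by omega]
      exact not_dvd_choose_pow_sub_one (by omega))
    refine Or.inr ⟨hbN', ?_, ?_, ?_⟩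
    · by_contra h3
      rw [if_pos (by omega)] at h1
      split_ifs at h1 <;> omega
    · by_contra h3
      rw [if_pos (not_lt.1 h3)] at h2
      split_ifs at h2 <;> omega
    · by_contra h3
      rw [if_neg (c := _ ≤ b + p ^ padicValNat p (b + 1)) h3] at h1
      omega
  · rintro (rfl | ⟨h1, h2, h3, h4⟩)
    · exact ⟨by omega, fun s h0 h1 => by omega⟩
    · refine ⟨by omega, fun s hs0 hsN hs => ?_⟩
      have h5 := Nat.le_of_dvd hs0
        (pow_dvd_of_not_dvd_choose_add (p := p) pow_padicValNat_dvd hs)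
      rw [if_neg (by omega), if_neg (by omega), if_pos (by omega)]
      norm_num

theorem generatingExponents_of_le {n m : ℕ} (hm : m < p ^ n) (h : m = 0 ∨ p ^ n ≤ 2 * m) :
    generatingExponents p (p ^ n) (stepWeight (max m (p ^ n - m))) (stepWeight (p ^ n - m)) =
      {p ^ n - 1} := by
  ext b
  rw [mem_generatingExponents_iff hm, Finset.mem_singleton, or_iff_left_iff_imp]
  rintro ⟨h1, h2, h3, h4⟩
  exfalso
  rcases h with rfl | h
  · have := add_pow_padicValNat_lt h1
    omega
  · rw [max_eq_left (by omega)] at h3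
    omega

/-- Apart from `p ^ n - 1`, the generating exponents are the reflections of the elements of
`dropSet p n m` below `p ^ n - m`. -/
theorem card_generatingExponents {n m : ℕ} (hm0 : m ≠ 0) (hm : 2 * m < p ^ n) :
    ((generatingExponents p (p ^ n) (stepWeight (max m (p ^ n - m)))
      (stepWeight (p ^ n - m))).card : ℤ) = 2 + alphaStat p n m - betaStat p n m := by
  have hmax : max m (p ^ n - m) = p ^ n - m := max_eq_right (by omega)
  -- The reflection `b ↦ p ^ n - 1 - b` preserves the valuation of `b + 1`.
  have hval : ∀ c, 0 < c → c < p ^ n → padicValNat p (p ^ n - c) = padicValNat p c := by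
    have aux : ∀ c, 0 < c → c < p ^ n → padicValNat p c ≤ padicValNat p (p ^ n - c) := by
      intro c h0 hc
      rw [← padicValNat_dvd_iff_le (by omega)]
      refine Nat.dvd_sub (pow_dvd_pow p ?_) pow_padicValNat_dvd
      exact (Nat.pow_le_pow_iff_right hp.out.one_lt).1
        ((pow_padicValNat_le h0.ne').trans hc.le)
    intro c h0 hc
    refine le_antisymm ?_ (aux c h0 hc)
    have := aux (p ^ n - c) (by omega) (by omega)
    rwa [show p ^ n - (p ^ n - c) = c by omega] at this
  have h1 : generatingExponents p (p ^ n) (stepWeight (max m (p ^ n - m)))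
      (stepWeight (p ^ n - m)) = insert (p ^ n - 1)
        (((dropSet p n m).filter (fun c => c < p ^ n - m)).image (fun c => p ^ n - 1 - c)) := by
    ext b
    rw [mem_generatingExponents_iff (by omega), Finset.mem_insert, hmax]
    refine or_congr_right ?_
    simp only [Finset.mem_image, Finset.mem_filter, dropSet, Finset.mem_range]
    constructor
    · rintro ⟨a1, a2, a3, a4⟩
      refine ⟨p ^ n - 1 - b, ⟨⟨by omega, by omega, ?_⟩, a3⟩, by omega⟩
      rw [show p ^ n - 1 - b = p ^ n - (b + 1) by omega, hval _ (by omega) a1]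
      omega
    · rintro ⟨c, ⟨⟨c1, c2, c3⟩, c4⟩, rfl⟩
      have h2 := hval c (by omega) c1
      rw [show p ^ n - 1 - c + 1 = p ^ n - c by omega, h2]
      have := pow_padicValNat_le (p := p) (s := c) (by omega)
      omega
  rw [h1, Finset.card_insert_of_notMem, Finset.card_image_of_injOn]
  · have := card_dropSet_filter_lt hm0 hm
    push_cast
    rw [this]; ring
  · intro a ha b hb hab
    simp only [Finset.coe_filter, Set.mem_ofPred_eq, dropSet, Finset.mem_filter,
      Finset.mem_range] at ha hb hab
    omega
  · intro h
    obtain ⟨c, hc, hc'⟩ := Finset.mem_image.1 h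
    simp only [dropSet, Finset.mem_filter, Finset.mem_range] at hc
    omega

theorem two_le_card_generatingExponents {n m : ℕ} (hm0 : m ≠ 0) (hm : 2 * m < p ^ n) :
    2 ≤ (generatingExponents p (p ^ n) (stepWeight (max m (p ^ n - m)))
      (stepWeight (p ^ n - m))).card := by
  have h1 : ({p ^ n - 1, p ^ n - 1 - m} : Finset ℕ) ⊆
      generatingExponents p (p ^ n) (stepWeight (max m (p ^ n - m))) (stepWeight (p ^ n - m)) := by
    intro b hb
    have hpos := pow_pos hp.out.pos (padicValNat p (b + 1))
    rw [mem_generatingExponents_iff (by omega), max_eq_right (by omega)]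
    rw [Finset.mem_insert, Finset.mem_singleton] at hb
    refine hb.imp_right fun h => ?_
    omega
  refine le_trans (Finset.card_pair ?_).ge (Finset.card_le_card h1)
  omega

end Generating

/-! ### Local rings with a residue map, embedding dimension and numbers of generators -/

section ResidueMap

variable {R k : Type*} [Ring R] [Field k] (ε : R →+* k)

theorem isLocalRing_of_isUnit (h : ∀ x, ε x ≠ 0 → IsUnit x) : IsLocalRing R := by
  have : Nontrivial R := ε.domain_nontrivial
  refine IsLocalRing.of_isUnit_or_isUnit_of_isUnit_add fun a b hab => ?_
  have h1 : ε a + ε b ≠ 0 := by rw [← map_add]; exact (hab.map ε).ne_zero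
  by_contra h2
  rw [not_or] at h2
  rw [not_not.1 (mt (h a) h2.1), not_not.1 (mt (h b) h2.2), add_zero] at h1
  exact h1 rfl

theorem jacobson_eq_ker_of_isUnit (h : ∀ x, ε x ≠ 0 → IsUnit x) :
    Ring.jacobson R = RingHom.ker ε := by
  have hle : ∀ I : Ideal R, I ≠ ⊤ → I ≤ RingHom.ker ε := fun I hI x hx => by
    rw [RingHom.mem_ker]
    by_contra h1
    exact hI (Ideal.eq_top_of_isUnit_mem _ hx (h x h1))
  have hker : RingHom.ker ε ≠ ⊤ := RingHom.ker_ne_top ε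
  have hmax : IsCoatom (RingHom.ker ε) :=
    ⟨hker, fun I hI => by
      by_contra h1
      exact absurd (hle I h1) (not_le_of_gt hI)⟩
  refine le_antisymm (sInf_le hmax) (le_sInf fun I hI => ?_)
  rw [hI.le_iff_eq hker |>.1 (hle I hI.1)]

/-- A semilinear surjection `f` from the maximal ideal `𝔐` onto `k ^ ι` with kernel in `𝔐 ^ 2`
computes the embedding dimension. -/
theorem embDim_eq_card (hε : Function.Surjective ε) (hJ : Ring.jacobson R = RingHom.ker ε)
    {ι : Type*} [Fintype ι] (f : Ring.jacobson R →+ (ι → k)) (hf : Function.Surjective f)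
    (hsmul : ∀ (r : R) (x : Ring.jacobson R), f (r • x) = ε r • f x)
    (hker : ∀ x, f x = 0 → x ∈ Ring.jacobson R • (⊤ : Submodule R (Ring.jacobson R))) :
    embDim R = Fintype.card ι := by
  let _ : Module R (ι → k) := Module.compHom (ι → k) ε
  let F : Ring.jacobson R →ₗ[R] (ι → k) := { f with map_smul' := hsmul }
  have hF : LinearMap.ker F = Ring.jacobson R • (⊤ : Submodule R (Ring.jacobson R)) := by
    refine le_antisymm (fun x hx => hker x hx) ?_
    rw [Submodule.smul_le]
    intro r hr x _
    rw [hJ, RingHom.mem_ker] at hr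
    change f (r • x) = 0
    rw [hsmul, hr, zero_smul]
  let j := (Submodule.quotEquivOfEq _ _ hF.symm).trans (F.quotKerEquivOfSurjective hf)
  let i : R ⧸ Ring.jacobson R →+* k := Ideal.Quotient.lift _ ε fun a ha => by
    rwa [hJ, RingHom.mem_ker] at ha
  have hi : Function.Bijective i := by
    constructor
    · rw [injective_iff_map_eq_zero]
      intro x hx
      obtain ⟨x, rfl⟩ := Ideal.Quotient.mk_surjective x
      rw [Ideal.Quotient.eq_zero_iff_mem, hJ]
      exact hx
    · intro y
      obtain ⟨x, rfl⟩ := hε y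
      exact ⟨Ideal.Quotient.mk _ x, rfl⟩
  have hrank := lift_rank_eq_of_equiv_equiv i j.toAddEquiv hi fun r m => by
    obtain ⟨r, rfl⟩ := Ideal.Quotient.mk_surjective r
    obtain ⟨m, rfl⟩ := Submodule.Quotient.mk_surjective _ m
    exact hsmul r m
  have h := congrArg Cardinal.toNat hrank
  rw [Cardinal.toNat_lift, Cardinal.toNat_lift] at h
  exact h.trans (Module.finrank_fintype_fun_eq_card k)

/-- A semilinear surjection onto `k ^ ι` bounds the number of generators of `M` from below, so a
generating family indexed by `ι` is minimal. -/
theorem isMinGenerators_card {M : Type*} [AddCommGroup M] [Module R M]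
    {ι : Type*} [Fintype ι] (f : M →+ (ι → k)) (hf : Function.Surjective f)
    (hsmul : ∀ (r : R) (x : M), f (r • x) = ε r • f x)
    (g : ι → M) (hg : Submodule.span R (Set.range g) = ⊤) :
    IsMinGenerators R M (Fintype.card ι) := by
  classical
  have hlow : ∀ S : Finset M, Submodule.span R (S : Set M) = ⊤ → Fintype.card ι ≤ S.card := by
    intro S hS
    have h1 : Submodule.span k ((S.image f : Finset (ι → k)) : Set (ι → k)) = ⊤ := by
      rw [eq_top_iff]
      intro y _
      obtain ⟨x, rfl⟩ := hf y
      have hx : x ∈ Submodule.span R (S : Set M) := hS ▸ Submodule.mem_top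
      induction hx using Submodule.span_induction with
      | mem x hx => exact Submodule.subset_span (by simpa using ⟨x, hx, rfl⟩)
      | zero => rw [map_zero]; exact Submodule.zero_mem _
      | add x y _ _ hx hy =>
        rw [map_add]
        exact Submodule.add_mem _ (hx trivial) (hy trivial)
      | smul r x _ hx => rw [hsmul]; exact Submodule.smul_mem _ _ (hx trivial)
    have h2 := finrank_span_finset_le_card (R := k) (S.image f)
    rw [Set.finrank, h1, finrank_top, Module.finrank_fintype_fun_eq_card] at h2
    exact h2.trans Finset.card_image_le
  refine ⟨⟨Finset.univ.image g, ?_, by simpa using hg⟩, fun c ⟨S, hc, hS⟩ => hc ▸ hlow S hS⟩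
  exact le_antisymm Finset.card_image_le (hlow _ (by simpa using hg))

end ResidueMap

/-! ### Orders with a divided power basis -/

section DividedPower

/-- A basis `E_0 = 1, E_1, …, E_(N-1)` of an `O`-algebra that multiplies like the divided powers
`D_s`, `D_s * D_r = choose (s + r) s • D_(s+r)`, rescaled to `E_s = t ^ (-w s) D_s`.
By `weight_add` the truncated subtraction in `mul` is a genuine one unless the binomial coefficient
vanishes modulo `p`. -/
structure IsDividedPowerBasis {O A : Type*} [CommRing O] [Ring A] [Algebra O A] (p N : ℕ)
    (w : ℕ → ℕ) (t : O) (E : Module.Basis (Fin N) O A) : Prop where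
  pos : 0 < N
  one : E ⟨0, pos⟩ = 1
  mul (s r : Fin N) : E s * E r = if h : (s : ℕ) + r < N then
    (((s + r : ℕ).choose s : O) * t ^ (w (s + r) - w s - w r)) • E ⟨s + r, h⟩ else 0
  weight_add (s r : ℕ) (h : s + r < N) (hsr : ¬ p ∣ (s + r).choose s) : w s + w r ≤ w (s + r)

/-- A basis `e_0, …, e_(N-1)` of a module over an algebra with divided power basis `E`, on which
`E` acts like the Hasse derivatives on powers, `D_s y ^ a = choose a s • y ^ (a - s)`, rescaled to
`e_a = t ^ (d a) y ^ a`. The role of `weight_add` is the same as in `IsDividedPowerBasis`. -/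
structure IsHasseBasis {O A M : Type*} [CommRing O] [Ring A] [Algebra O A] [AddCommGroup M]
    [Module O M] [Module A M] (p N : ℕ) (w d : ℕ → ℕ) (t : O) (E : Module.Basis (Fin N) O A)
    (e : Module.Basis (Fin N) O M) : Prop where
  smul (s a : Fin N) : E s • e a = if s ≤ a then
    (((a : ℕ).choose s : O) * t ^ (d a - d (a - s) - w s)) • e ⟨a - s, by omega⟩ else 0
  weight_add (b s : ℕ) (h : b + s < N) (hsb : ¬ p ∣ (b + s).choose s) : d b + w s ≤ d (b + s)

variable {O A : Type*} [CommRing O] [Ring A] [Algebra O A]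
  {p N : ℕ} {w : ℕ → ℕ} {t : O} {E : Module.Basis (Fin N) O A}

namespace IsDividedPowerBasis

variable (hE : IsDividedPowerBasis p N w t E)

include hE

theorem commute (s r : Fin N) : Commute (E s) (E r) := by
  rw [Commute, SemiconjBy, hE.mul, hE.mul]
  by_cases h : (s : ℕ) + r < N
  · have h' : (r : ℕ) + s < N := by omega
    rw [dif_pos h, dif_pos h', Nat.choose_symm_add]
    simp only [Nat.add_comm (r : ℕ), Nat.sub_right_comm _ (w r) (w s)]
  · rw [dif_neg h, dif_neg (by omega)]

/-- The coefficient of `E_0 = 1`, a ring homomorphism. -/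
noncomputable def augmentation : A →ₐ[O] O :=
  AlgHom.ofLinearMap (E.coord ⟨0, hE.pos⟩) (by rw [← hE.one]; simp) (by
    intro x y
    have h : (LinearMap.mul O A).compr₂ (E.coord ⟨0, hE.pos⟩) =
        (LinearMap.mul O O).compl₁₂ (E.coord ⟨0, hE.pos⟩) (E.coord ⟨0, hE.pos⟩) := by
      refine LinearMap.ext_basis E E fun s r => ?_
      simp only [LinearMap.compr₂_apply, LinearMap.mul_apply', LinearMap.compl₁₂_apply,
        Module.Basis.coord_apply, hE.mul, Module.Basis.repr_self, Finsupp.single_apply, Fin.ext_iff]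
      by_cases h0 : (s : ℕ) = 0 ∧ (r : ℕ) = 0
      · simp [h0, hE.pos]
      · rw [show (if (s : ℕ) = 0 then (1 : O) else 0) * (if (r : ℕ) = 0 then (1 : O) else 0) = 0 by
          split_ifs <;> simp_all]
        split_ifs with h
        · rw [map_smul, Finsupp.smul_apply, Module.Basis.repr_self, Finsupp.single_apply,
            if_neg, smul_zero]
          rw [Fin.ext_iff]
          simp only
          omega
        · simp
    exact LinearMap.congr_fun (LinearMap.congr_fun h x) y)

/-- Powers of `E_s` are multiples of `E_(s * i)`, as long as `s * i < N`. -/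
theorem isNilpotent_of_ne_zero (s : Fin N) (hs : (s : ℕ) ≠ 0) : IsNilpotent (E s) := by
  have h : ∀ i : ℕ, E s ^ (i + 1) = 0 ∨
      ∃ (c : O) (h : (s : ℕ) * (i + 1) < N), E s ^ (i + 1) = c • E ⟨s * (i + 1), h⟩ := by
    intro i
    induction i with
    | zero => exact Or.inr ⟨1, by simp, by simp⟩
    | succ i ih =>
      rw [pow_succ]
      rcases ih with ih | ⟨c, h, ih⟩
      · exact Or.inl (by rw [ih, zero_mul])
      · rw [ih, smul_mul_assoc, hE.mul]
        split_ifs with h2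
        · right
          have h3 : (s : ℕ) * (i + 1 + 1) = s * (i + 1) + s := by ring
          simp only [h3]
          exact ⟨_, h2, smul_smul _ _ _⟩
        · exact Or.inl (smul_zero _)
  rcases h N with h | ⟨c, h, -⟩
  · exact ⟨_, h⟩
  · have := Nat.le_mul_of_pos_left (N + 1) (Nat.pos_of_ne_zero hs)
    omega

variable [IsLocalRing O]

/-- The residue map of the local ring `A`. -/
noncomputable def residueMap : A →+* ResidueField O :=
  (residue O).comp hE.augmentation.toRingHom

theorem residueMap_apply (x : A) : hE.residueMap x = residue O (E.repr x ⟨0, hE.pos⟩) := rfl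

theorem residueMap_surjective : Function.Surjective hE.residueMap := by
  intro y
  obtain ⟨c, rfl⟩ := residue_surjective y
  exact ⟨algebraMap O A c, congrArg (residue O) (hE.augmentation.commutes c)⟩

/-- The `E_s` with `s > 0` are commuting nilpotents, so `x` is a unit as soon as its coefficient at
`E_0 = 1` is one. -/
theorem isUnit_of_residueMap_ne_zero (x : A) (hx : hE.residueMap x ≠ 0) : IsUnit x := by
  set c := E.repr x ⟨0, hE.pos⟩ with hc
  have hcu : IsUnit c := by
    rwa [residueMap_apply, residue_ne_zero_iff_isUnit] at hx
  have h1 : x = algebraMap O A c +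
      ∑ s ∈ Finset.univ.erase ⟨0, hE.pos⟩, E.repr x s • E s := by
    conv_lhs => rw [← E.sum_repr x]
    rw [← Finset.add_sum_erase _ _ (Finset.mem_univ ⟨0, hE.pos⟩), hE.one,
      Algebra.algebraMap_eq_smul_one]
  have h2 : IsNilpotent (∑ s ∈ Finset.univ.erase ⟨0, hE.pos⟩, E.repr x s • E s) := by
    refine Commute.isNilpotent_sum (fun s hs => ?_) fun s r _ _ => ?_
    · refine IsNilpotent.smul (hE.isNilpotent_of_ne_zero s fun h => ?_) _
      exact (Finset.mem_erase.1 hs).1 (Fin.ext h)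
    · exact ((hE.commute s r).smul_left _).smul_right _
  rw [h1]
  exact h2.isUnit_add_left_of_commute (hcu.map _) (Algebra.commute_algebraMap_right _ _)

theorem isLocalRing : IsLocalRing A :=
  isLocalRing_of_isUnit hE.residueMap hE.isUnit_of_residueMap_ne_zero

theorem jacobson_eq : Ring.jacobson A = RingHom.ker hE.residueMap :=
  jacobson_eq_ker_of_isUnit hE.residueMap hE.isUnit_of_residueMap_ne_zero

/-- Modulo the maximal ideal, the coordinate at an indecomposable exponent is a derivation. -/
theorem residue_repr_mul [CharP O p] (ht : t ∈ maximalIdeal O) {u : Fin N}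
    (hu : (u : ℕ) ∈ indecomposables p N w) (x y : A) :
    residue O (E.repr (x * y) u) = hE.residueMap x * residue O (E.repr y u) +
      residue O (E.repr x u) * hE.residueMap y := by
  let ρ := Algebra.linearMap O (ResidueField O)
  have h : (LinearMap.mul O A).compr₂ (ρ ∘ₗ E.coord u) =
      (LinearMap.mul O (ResidueField O)).compl₁₂ (ρ ∘ₗ E.coord ⟨0, hE.pos⟩) (ρ ∘ₗ E.coord u) +
      (LinearMap.mul O (ResidueField O)).compl₁₂ (ρ ∘ₗ E.coord u) (ρ ∘ₗ E.coord ⟨0, hE.pos⟩) := by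
    rw [mem_indecomposables] at hu
    refine LinearMap.ext_basis E E fun s r => ?_
    have hs0 : ∀ r : Fin N, (r : ℕ) = 0 → E r = 1 := fun r hr => by
      rw [← hE.one]; congr 1; exact Fin.ext hr
    have hρ : ρ 1 = 1 := map_one (algebraMap O (ResidueField O))
    have hu0 : ∀ r : Fin N, (r : ℕ) = 0 → E.repr (E r) u = 0 := fun r hr => by
      rw [E.repr_self, Finsupp.single_apply, if_neg]
      rintro rfl
      omega
    simp only [LinearMap.compr₂_apply, LinearMap.mul_apply', LinearMap.compl₁₂_apply,
      LinearMap.add_apply, LinearMap.comp_apply, Module.Basis.coord_apply]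
    by_cases hs : (s : ℕ) = 0
    · rw [hu0 s hs, E.repr_self s, Finsupp.single_apply, if_pos (Fin.ext hs), hs0 s hs]
      simp [hρ]
    by_cases hr : (r : ℕ) = 0
    · rw [hu0 r hr, E.repr_self r, Finsupp.single_apply, if_pos (Fin.ext hr), hs0 r hr]
      simp [hρ]
    have h1 : ∀ r : Fin N, (r : ℕ) ≠ 0 → E.repr (E r) ⟨0, hE.pos⟩ = 0 := fun r hr => by
      rw [E.repr_self, Finsupp.single_apply, if_neg]
      rintro rfl
      exact hr rfl
    rw [h1 s hs, h1 r hr, map_zero, zero_mul, mul_zero, add_zero, hE.mul]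
    split_ifs with hsr
    · rw [map_smul, Finsupp.smul_apply, E.repr_self, Finsupp.single_apply]
      split_ifs with hu'
      · rw [smul_eq_mul, mul_one]
        change residue O _ = 0
        rw [residue_eq_zero_iff]
        by_cases hdvd : p ∣ (s + r : ℕ).choose s
        · rw [(CharP.cast_eq_zero_iff O p _).2 hdvd, zero_mul]
          exact Ideal.zero_mem _
        · refine Ideal.mul_mem_left _ _ (Ideal.pow_mem_of_mem _ ht _ ?_)
          have hu2 : (u : ℕ) = s + r := (congrArg Fin.val hu').symm
          rw [hu2] at hu
          have := hu.2.2 s (by omega) (by omega) hdvd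
          rw [Nat.add_sub_cancel_left] at this
          omega
      · simp
    · simp
  have h2 := LinearMap.congr_fun (LinearMap.congr_fun h x) y
  exact h2

/-- A basis of `𝔐 / 𝔐 ^ 2` is given by `t` and the `E_u` with `u` indecomposable. -/
theorem embDim_eq [IsDomain O] [Fact p.Prime] [CharP O p] (ht : maximalIdeal O = Ideal.span {t})
    (ht0 : t ≠ 0) : embDim A = (indecomposables p N w).card + 1 := by
  classical
  set J := Ring.jacobson A with hJdef
  have hJ : J = RingHom.ker hE.residueMap := hE.jacobson_eq
  have htm : t ∈ maximalIdeal O := ht ▸ Ideal.mem_span_singleton_self t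
  have hlt : ∀ u : indecomposables p N w, (u : ℕ) < N := fun u => (mem_indecomposables.1 u.2).1
  have hres : ∀ x : J, hE.residueMap x.1 = 0 := fun x => hJ.le x.2
  have hdvd : ∀ x : J, ∃ c, E.repr x.1 ⟨0, hE.pos⟩ = t * c := fun x => by
    have := hres x
    rwa [residueMap_apply, residue_eq_zero_iff, ht, Ideal.mem_span_singleton] at this
  choose τ hτ using hdvd
  let f₀ : J → (Option (indecomposables p N w) → ResidueField O) := fun x i =>
    i.elim (residue O (τ x)) fun u => residue O (E.repr x.1 ⟨u, hlt u⟩)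
  let f : J →+ (Option (indecomposables p N w) → ResidueField O) := AddMonoidHom.mk' f₀ (by
    intro x y
    funext i
    rcases i with _ | u
    · have h : τ (x + y) = τ x + τ y := by
        refine mul_left_cancel₀ ht0 ?_
        rw [← hτ, mul_add, ← hτ, ← hτ, Submodule.coe_add, map_add, Finsupp.add_apply]
      exact (congrArg (residue O) h).trans (map_add _ _ _)
    · change residue O (E.repr ((x : A) + y) _) = residue O _ + residue O _
      rw [map_add, Finsupp.add_apply, map_add])
  rw [embDim_eq_card hE.residueMap hE.residueMap_surjective hJ f, Fintype.card_option,
    Fintype.card_coe]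
  · intro g
    choose g' hg' using fun i => residue_surjective (g i)
    let x : A := E.equivFun.symm fun s => if (s : ℕ) = 0 then t * g' none else
      if h : (s : ℕ) ∈ indecomposables p N w then g' (some ⟨s, h⟩) else 0
    have hx : ∀ s, E.repr x s = if (s : ℕ) = 0 then t * g' none else
        if h : (s : ℕ) ∈ indecomposables p N w then g' (some ⟨s, h⟩) else 0 := fun s => by
      rw [← E.equivFun_apply, LinearEquiv.apply_symm_apply]
    have hxJ : x ∈ J := by
      rw [hJ, RingHom.mem_ker, residueMap_apply, hx, if_pos rfl, residue_eq_zero_iff]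
      exact Ideal.mul_mem_right _ _ htm
    refine ⟨⟨x, hxJ⟩, ?_⟩
    funext i
    rw [← hg' i]
    rcases i with _ | u
    · refine congrArg (residue O) (mul_left_cancel₀ ht0 ?_)
      rw [← hτ, hx, if_pos rfl]
    · refine congrArg (residue O) ?_
      rw [hx, if_neg, dif_pos u.2]
      exact (mem_indecomposables.1 u.2).2.1.ne'
  · intro r x
    funext i
    rcases i with _ | u
    · have h : τ (r • x) = E.repr r ⟨0, hE.pos⟩ * τ x := by
        refine mul_left_cancel₀ ht0 ?_
        rw [← hτ, mul_left_comm, ← hτ]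
        exact map_mul hE.augmentation r x.1
      exact (congrArg (residue O) h).trans (map_mul _ _ _)
    · have h := hE.residue_repr_mul htm (u := ⟨u, hlt u⟩) u.2 r x.1
      rw [hres x, mul_zero, add_zero] at h
      exact h
  · intro x hx
    -- `S` is the left ideal `J ^ 2`, which contains each term of the expansion of `x`.
    set S : Submodule A A := (J • (⊤ : Submodule A J)).map J.subtype with hS
    have hmem : ∀ y z : A, y ∈ J → z ∈ J → y * z ∈ S := fun y z hy hz =>
      ⟨y • ⟨z, hz⟩, Submodule.smul_mem_smul hy Submodule.mem_top, rfl⟩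
    have hsmul : ∀ (c : O) (y : A), y ∈ S → c • y ∈ S := fun c y hy => by
      rw [Algebra.smul_def]
      exact S.smul_mem _ hy
    have htJ : algebraMap O A t ∈ J := by
      rw [hJ, RingHom.mem_ker]
      have : hE.residueMap (algebraMap O A t) = residue O t :=
        congrArg (residue O) (hE.augmentation.commutes t)
      rw [this, residue_eq_zero_iff]
      exact htm
    have hEJ : ∀ s : Fin N, (s : ℕ) ≠ 0 → E s ∈ J := fun s hs => by
      rw [hJ, RingHom.mem_ker, residueMap_apply, E.repr_self, Finsupp.single_apply, if_neg,
        map_zero]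
      rintro rfl
      exact hs rfl
    have hxS : x.1 ∈ S := by
      rw [← E.sum_repr x.1]
      refine S.sum_mem fun s _ => ?_
      by_cases hs : (s : ℕ) = 0
      · have hs' : s = ⟨0, hE.pos⟩ := Fin.ext hs
        have h1 : residue O (τ x) = 0 := congrFun hx none
        rw [residue_eq_zero_iff, ht, Ideal.mem_span_singleton] at h1
        obtain ⟨c, hc⟩ := h1
        rw [hs', hτ, hc, hE.one, ← mul_assoc, mul_comm, mul_smul, ← Algebra.algebraMap_eq_smul_one,
          map_mul]
        exact hsmul _ _ (hmem _ _ htJ htJ)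
      by_cases hind : (s : ℕ) ∈ indecomposables p N w
      · have h1 : residue O (E.repr x.1 s) = 0 := congrFun hx (some ⟨s, hind⟩)
        rw [residue_eq_zero_iff, ht, Ideal.mem_span_singleton] at h1
        obtain ⟨c, hc⟩ := h1
        rw [hc, mul_comm, mul_smul, Algebra.smul_def t]
        exact hsmul _ _ (hmem _ _ htJ (hEJ s hs))
      · have h1 : ∃ r, 0 < r ∧ r < (s : ℕ) ∧ ¬ p ∣ (s : ℕ).choose r ∧
            w s ≤ w r + w (s - r) := by
          by_contra hcon
          refine hind (mem_indecomposables.2 ⟨s.2, Nat.pos_of_ne_zero hs, fun r h0 h1 h2 => ?_⟩)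
          by_contra h3
          exact hcon ⟨r, h0, h1, h2, not_lt.1 h3⟩
        obtain ⟨r, h0, h1, h2, h3⟩ := h1
        have h4 := hE.mul ⟨r, h1.trans s.2⟩ ⟨s - r, by omega⟩
        have h5 : r + (s - r) = s := by omega
        simp only [h5, s.2, dif_pos] at h4
        rw [Nat.sub_sub, Nat.sub_eq_zero_of_le h3, pow_zero, mul_one] at h4
        have hunit : IsUnit ((s : ℕ).choose r : O) :=
          (CharP.isUnit_natCast_iff (Fact.out : p.Prime)).2 h2
        obtain ⟨v, hv⟩ := hunit
        have h6 : E s = (↑v⁻¹ : O) • (E ⟨r, h1.trans s.2⟩ * E ⟨s - r, by omega⟩) := by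
          rw [h4, smul_smul, ← hv, Units.inv_mul, one_smul]
        rw [h6]
        exact hsmul _ _ (hsmul _ _ (hmem _ _ (hEJ _ (by simp only; omega))
          (hEJ _ (by simp only; omega))))
    obtain ⟨y, hy, hyx⟩ := hxS
    rwa [← Subtype.ext (a1 := y) (a2 := x) hyx]

end IsDividedPowerBasis

namespace IsHasseBasis

variable {M : Type*} [AddCommGroup M] [Module O M] [Module A M] [IsScalarTower O A M]
  {d : ℕ → ℕ} {e : Module.Basis (Fin N) O M} (he : IsHasseBasis p N w d t E e)

include he

/-- Every `e_a` is generated by the `e_b` with `b` a generating exponent: a non-generating `b` is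
reached from some larger `b + s`. -/
theorem span_generatingExponents [Fact p.Prime] [CharP O p] :
    Submodule.span A (Set.range fun b : generatingExponents p N w d =>
      e ⟨b, (mem_generatingExponents.1 b.2).1⟩) = ⊤ := by
  set S := Submodule.span A (Set.range fun b : generatingExponents p N w d =>
      e ⟨b, (mem_generatingExponents.1 b.2).1⟩) with hS
  have hO : ∀ (c : O) (x : M), x ∈ S → c • x ∈ S := fun c x hx => by
    rw [← algebraMap_smul A c x]
    exact S.smul_mem _ hx
  have key : ∀ j : ℕ, ∀ b : Fin N, N - 1 - b ≤ j → e b ∈ S := by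
    intro j
    induction j with
    | zero =>
      intro b hb
      refine Submodule.subset_span ⟨⟨b, mem_generatingExponents.2 ⟨b.2, fun s h0 h1 => ?_⟩⟩, rfl⟩
      omega
    | succ j ih =>
      intro b hb
      by_cases hgen : (b : ℕ) ∈ generatingExponents p N w d
      · exact Submodule.subset_span ⟨⟨b, hgen⟩, rfl⟩
      have h1 : ∃ s, 0 < s ∧ (b : ℕ) + s < N ∧ ¬ p ∣ (b + s : ℕ).choose s ∧
          d (b + s) ≤ d b + w s := by
        by_contra hcon
        refine hgen (mem_generatingExponents.2 ⟨b.2, fun s h0 h1 h2 => ?_⟩)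
        by_contra h3
        exact hcon ⟨s, h0, h1, h2, not_lt.1 h3⟩
      obtain ⟨s, h0, h1, h2, h3⟩ := h1
      have h4 := he.smul ⟨s, by omega⟩ ⟨b + s, h1⟩
      rw [if_pos (Fin.mk_le_mk.2 (by omega))] at h4
      simp only [Nat.add_sub_cancel] at h4
      rw [Nat.sub_sub, Nat.sub_eq_zero_of_le h3, pow_zero, mul_one] at h4
      obtain ⟨v, hv⟩ : IsUnit ((b + s : ℕ).choose s : O) :=
        (CharP.isUnit_natCast_iff (Fact.out : p.Prime)).2 h2
      have h6 : e b = (↑v⁻¹ : O) • (E ⟨s, by omega⟩ • e ⟨b + s, h1⟩) := by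
        rw [h4, smul_smul, ← hv, Units.inv_mul, one_smul]
      rw [h6]
      exact hO _ _ (S.smul_mem _ (ih _ (by simp only; omega)))
  rw [eq_top_iff]
  intro x _
  rw [← e.sum_repr x]
  exact S.sum_mem fun b _ => hO _ _ (key _ b le_rfl)

variable (hE : IsDividedPowerBasis p N w t E)

include hE

/-- Modulo the maximal ideals, the coordinate at a generating exponent is linear. -/
theorem residue_repr_smul [IsLocalRing O] [CharP O p] (ht : t ∈ maximalIdeal O) {b : Fin N}
    (hb : (b : ℕ) ∈ generatingExponents p N w d) (r : A) (x : M) :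
    residue O (e.repr (r • x) b) = hE.residueMap r * residue O (e.repr x b) := by
  let ρ := Algebra.linearMap O (ResidueField O)
  have h : (Algebra.lsmul O O M : A →ₐ[O] Module.End O M).toLinearMap.compr₂ (ρ ∘ₗ e.coord b) =
      (LinearMap.mul O (ResidueField O)).compl₁₂ (ρ ∘ₗ E.coord ⟨0, hE.pos⟩) (ρ ∘ₗ e.coord b) := by
    rw [mem_generatingExponents] at hb
    refine LinearMap.ext_basis E e fun s a => ?_
    simp only [LinearMap.compr₂_apply, AlgHom.toLinearMap_apply, Algebra.lsmul_coe,
      LinearMap.mul_apply', LinearMap.compl₁₂_apply, LinearMap.comp_apply,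
      Module.Basis.coord_apply]
    by_cases hs : (s : ℕ) = 0
    · have hs' : s = ⟨0, hE.pos⟩ := Fin.ext hs
      have hρ : ρ 1 = 1 := map_one (algebraMap O (ResidueField O))
      rw [hs', E.repr_self, Finsupp.single_eq_same, hρ, one_mul, hE.one, one_smul]
    · have h1 : E.repr (E s) ⟨0, hE.pos⟩ = 0 := by
        rw [E.repr_self, Finsupp.single_apply, if_neg]
        rintro rfl
        exact hs rfl
      rw [h1, map_zero, zero_mul, he.smul]
      split_ifs with hsa
      · rw [map_smul, Finsupp.smul_apply, e.repr_self, Finsupp.single_apply]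
        split_ifs with hb'
        · rw [smul_eq_mul, mul_one]
          change residue O _ = 0
          rw [residue_eq_zero_iff]
          by_cases hdvd : p ∣ (a : ℕ).choose s
          · rw [(CharP.cast_eq_zero_iff O p _).2 hdvd, zero_mul]
            exact Ideal.zero_mem _
          · refine Ideal.mul_mem_left _ _ (Ideal.pow_mem_of_mem _ ht _ ?_)
            have hsa' : (s : ℕ) ≤ a := hsa
            have hb2 : (b : ℕ) = a - s := (congrArg Fin.val hb').symm
            have hba : (b : ℕ) + s = a := by omega
            have := hb.2 s (by omega) (by omega) (by rwa [hba])
            rw [hba, hb2] at this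
            omega
        · simp
      · simp
  exact LinearMap.congr_fun (LinearMap.congr_fun h r) x

/-- The `e_b` with `b` a generating exponent form a minimal system of generators. -/
theorem isMinGenerators [IsLocalRing O] [Fact p.Prime] [CharP O p] (ht : t ∈ maximalIdeal O) :
    IsMinGenerators A M (generatingExponents p N w d).card := by
  classical
  have hlt : ∀ u : generatingExponents p N w d, (u : ℕ) < N :=
    fun u => (mem_generatingExponents.1 u.2).1
  let f : M →+ (generatingExponents p N w d → ResidueField O) := AddMonoidHom.mk'
    (fun x b => residue O (e.repr x ⟨b, hlt b⟩)) fun x y => by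
      funext b
      simp
  rw [← Fintype.card_coe]
  refine isMinGenerators_card hE.residueMap f (fun g => ?_) (fun r x => ?_) _
    (he.span_generatingExponents)
  · choose g' hg' using fun i => residue_surjective (g i)
    refine ⟨e.equivFun.symm fun s =>
      if h : (s : ℕ) ∈ generatingExponents p N w d then g' ⟨s, h⟩ else 0, ?_⟩
    funext b
    change residue O (e.repr _ _) = _
    rw [← e.equivFun_apply, LinearEquiv.apply_symm_apply, dif_pos b.2, hg']
  · funext b
    exact he.residue_repr_smul hE ht (b := ⟨b, hlt b⟩) b.2 r x

/-- Since the ring and the module have the same rank over `O`, the module is free exactly when it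
is cyclic. -/
theorem free_iff [IsLocalRing O] [IsDomain O] [Fact p.Prime] [CharP O p] (ht : t ∈ maximalIdeal O) :
    Module.Free A M ↔ (generatingExponents p N w d).card = 1 := by
  classical
  have hmin := he.isMinGenerators hE ht
  constructor
  · intro hfree
    let B := Module.Free.chooseBasis A M
    have h1 := Nat.card_congr ((E.smulTower B).indexEquiv e)
    rw [Nat.card_prod, Nat.card_fin] at h1
    have h2 : Nat.card (Module.Free.ChooseBasisIndex A M) = 1 :=
      Nat.eq_of_mul_eq_mul_left hE.pos (h1.trans (mul_one N).symm)
    obtain ⟨hsub, ⟨i⟩⟩ := Nat.card_eq_one_iff_unique.1 h2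
    refine le_antisymm (hmin.2 ⟨{B i}, Finset.card_singleton _, ?_⟩) (Finset.card_pos.2 ⟨N - 1, ?_⟩)
    · rw [← B.span_eq, Finset.coe_singleton]
      congr 1
      ext x
      constructor
      · rintro rfl
        exact ⟨i, rfl⟩
      · rintro ⟨j, rfl⟩
        rw [Subsingleton.elim j i]
        rfl
    · have := hE.pos
      exact mem_generatingExponents.2 ⟨by omega, fun s h0 h1 => by omega⟩
  · intro h
    rw [h] at hmin
    obtain ⟨S, hS, hspan⟩ := hmin.1
    obtain ⟨x, rfl⟩ := Finset.card_eq_one.1 hS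
    let f : A →ₗ[A] M := LinearMap.toSpanSingleton A M x
    have hf : Function.Surjective f := by
      rw [← LinearMap.range_eq_top, LinearMap.range_toSpanSingleton, ← hspan,
        Finset.coe_singleton]
    have hfinite : Module.Finite O M := Module.Finite.of_basis e
    have hbij := OrzechProperty.bijective_of_surjective_of_injective
      (E.equiv e (Equiv.refl _)).toLinearMap (f.restrictScalars O)
      (E.equiv e (Equiv.refl _)).injective hf
    exact Module.Free.of_equiv (LinearEquiv.ofBijective f hbij)

end IsHasseBasis
end DividedPower

/-! ### Valuations of totally and weakly ramified extensions -/

section Valuation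

open WithZero

/-- The properties of the normalised valuation `v` of `L` (written multiplicatively, a uniformizer
having value `exp (-1)`) by which total and weak ramification of `L / K` enter the argument. -/
structure IsTotWeak (K : Type*) {L : Type*} [Field K] [Field L] [Algebra K L]
    (v : Valuation L ℤᵐ⁰) : Prop where
  exists_uniformizer : ∃ ϖ, v ϖ = exp (-1)
  apply_aut (σ : L ≃ₐ[K] L) (x : L) : v (σ x) = v x
  base (c : K) (hc : c ≠ 0) : ∃ j : ℤ, v (algebraMap K L c) = exp (Module.finrank K L * j)
  weak (σ : L ≃ₐ[K] L) (hσ : σ ≠ 1) : ∃ x, v x ≤ 1 ∧ exp (-3) < v (σ x - x)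

theorem eq_of_modEq_of_lt {N : ℕ} (i j : Fin N) (h : (i : ℤ) ≡ (j : ℤ) [ZMOD N]) : i = j := by
  have h1 := (Int.natCast_modEq_iff.1 h).eq_of_lt_of_lt i.2 j.2
  exact Fin.ext h1

theorem eq_of_neg_modEq_of_lt {N : ℕ} (i j : Fin N) (h : -(i : ℤ) ≡ -(j : ℤ) [ZMOD N]) :
    i = j :=
  eq_of_modEq_of_lt i j (by simpa using h.neg)

theorem lt_exp_iff {x : ℤᵐ⁰} {a : ℤ} : x < exp a ↔ x ≤ exp (a - 1) := by
  rcases eq_or_ne x 0 with rfl | hx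
  · simp
  · lift x to ℤ using hx
    rw [exp_lt_exp, exp_le_exp]
    omega

theorem lt_one_iff_le_exp {x : ℤᵐ⁰} : x < 1 ↔ x ≤ exp (-1) := by
  rw [← exp_zero, lt_exp_iff, zero_sub]

variable {K L : Type*} [Field K] [Field L] [Algebra K L]
  {v : Valuation L ℤᵐ⁰} (hv : IsTotWeak K v)

namespace IsTotWeak

include hv

theorem base_cases (c : K) : v (algebraMap K L c) = 0 ∨
    ∃ j : ℤ, v (algebraMap K L c) = exp (Module.finrank K L * j) := by
  rcases eq_or_ne c 0 with rfl | hc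
  · exact Or.inl (by simp)
  · exact Or.inr (hv.base c hc)

/-- In a linear combination of elements whose valuations are distinct modulo `[L : K]` there is no
cancellation. -/
theorem le_apply_sum {ι : Type*} [Fintype ι] {x : ι → L} {f : ι → ℤ}
    (hx : ∀ i, v (x i) = exp (f i))
    (hf : ∀ i j, f i ≡ f j [ZMOD Module.finrank K L] → i = j) (c : ι → K) (i : ι) :
    v (c i • x i) ≤ v (∑ j, c j • x j) := by
  classical
  obtain ⟨m, -, hm⟩ := Finset.exists_max_image Finset.univ (fun j => v (c j • x j)) ⟨i, by simp⟩
  refine (hm i (Finset.mem_univ i)).trans ?_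
  rcases eq_or_ne (v (c m • x m)) 0 with h0 | h0
  · rw [h0]; exact zero_le
  refine (Valuation.map_sum_eq_of_lt v (f := fun j => c j • x j) (Finset.mem_univ m)
    fun j hj => ?_).ge
  refine lt_of_le_of_ne (hm j (Finset.mem_univ j)) fun h => ?_
  have hne : m ≠ j := by
    simp at hj
    tauto
  refine hne (hf _ _ ?_)
  rw [Algebra.smul_def, map_mul, hx] at h h0
  rw [Algebra.smul_def, map_mul, hx] at h
  rcases hv.base_cases (c m) with h1 | ⟨a, ha⟩
  · simp [h1] at h0
  rcases hv.base_cases (c j) with h2 | ⟨b, hb⟩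
  · rw [h2, ha] at h
    simp at h
  rw [ha, hb, ← exp_add, ← exp_add, exp_inj] at h
  rw [Int.modEq_iff_dvd]
  exact ⟨a - b, by linarith⟩

theorem linearIndependent {ι : Type*} [Fintype ι] {x : ι → L} {f : ι → ℤ}
    (hx : ∀ i, v (x i) = exp (f i))
    (hf : ∀ i j, f i ≡ f j [ZMOD Module.finrank K L] → i = j) : LinearIndependent K x := by
  rw [Fintype.linearIndependent_iff]
  intro c hc i
  have h := hv.le_apply_sum hx hf c i
  rw [hc, map_zero, le_zero_iff, map_eq_zero, smul_eq_zero] at h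
  refine h.resolve_right fun h0 => ?_
  have := hx i
  rw [h0, map_zero] at this
  exact exp_ne_zero this.symm

variable [FiniteDimensional K L]

/-- Elements of `K` have valuations divisible by `[L : K]`. -/
theorem base_le_of_lt {c : K} {i : ℤ} (hi : i < Module.finrank K L)
    (h : v (algebraMap K L c) ≤ exp i) : v (algebraMap K L c) ≤ 1 := by
  rcases hv.base_cases c with h0 | ⟨j, hj⟩
  · rw [h0]; exact zero_le_one
  · rw [hj, exp_le_exp] at h
    rw [hj, ← exp_zero, exp_le_exp]
    have : (0 : ℤ) < Module.finrank K L := mod_cast Module.finrank_pos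
    by_contra hcon
    have hj1 : 1 ≤ j := by
      by_contra h1
      exact hcon (mul_nonpos_of_nonneg_of_nonpos this.le (by omega))
    nlinarith

theorem base_le_of_lt_one {c : K} (h : v (algebraMap K L c) < 1) :
    v (algebraMap K L c) ≤ exp (-Module.finrank K L : ℤ) := by
  rcases hv.base_cases c with h0 | ⟨j, hj⟩
  · rw [h0]; exact zero_le
  · rw [hj, ← exp_zero, exp_lt_exp] at h
    rw [hj, exp_le_exp]
    have : (0 : ℤ) < Module.finrank K L := mod_cast Module.finrank_pos
    have hj1 : j ≤ -1 := by
      by_contra h1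
      have := mul_nonneg this.le (show 0 ≤ j by omega)
      omega
    nlinarith

/-- Every integral element of `L` is an integral combination of the powers of a uniformizer. -/
theorem exists_sum_pow {ϖ : L} (hϖ : v ϖ = exp (-1)) {z : L} (hz : v z ≤ 1) :
    ∃ c : Fin (Module.finrank K L) → K, (∀ i, v (algebraMap K L (c i)) ≤ 1) ∧
      z = ∑ i, c i • ϖ ^ (i : ℕ) := by
  have hx : ∀ i : Fin (Module.finrank K L), v (ϖ ^ (i : ℕ)) = exp (-(i : ℤ)) := fun i => by
    rw [map_pow, hϖ, ← exp_nsmul]; simp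
  have hli := hv.linearIndependent hx eq_of_neg_modEq_of_lt
  let B := basisOfLinearIndependentOfCardEqFinrank' _ hli (Fintype.card_fin _)
  have hB : ∀ i, B i = ϖ ^ (i : ℕ) := fun i => by simp [B]
  refine ⟨B.repr z, fun i => ?_, ?_⟩
  · have h := hv.le_apply_sum hx eq_of_neg_modEq_of_lt (B.repr z) i
    simp_rw [← hB] at h
    rw [B.sum_repr, hB, Algebra.smul_def, map_mul, hx] at h
    refine hv.base_le_of_lt (i := i) (by exact_mod_cast i.2) ?_
    have h1 := mul_le_mul_left (h.trans hz) (exp (i : ℤ))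
    rwa [mul_assoc, ← exp_add, neg_add_cancel, exp_zero, mul_one, one_mul] at h1
  · simp_rw [← hB]
    exact (B.sum_repr z).symm

/-- Total ramification: the residue fields of `K` and `L` coincide. -/
theorem exists_base_sub_lt {z : L} (hz : v z ≤ 1) :
    ∃ c : K, v (algebraMap K L c) ≤ 1 ∧ v (z - algebraMap K L c) < 1 := by
  obtain ⟨ϖ, hϖ⟩ := hv.exists_uniformizer
  obtain ⟨c, hc, rfl⟩ := hv.exists_sum_pow hϖ hz
  have hpos : 0 < Module.finrank K L := Module.finrank_pos
  refine ⟨c ⟨0, hpos⟩, hc _, ?_⟩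
  rw [← Finset.add_sum_erase _ _ (Finset.mem_univ ⟨0, hpos⟩), pow_zero,
    Algebra.smul_def (c ⟨0, hpos⟩), mul_one, add_sub_cancel_left]
  refine Valuation.map_sum_lt' v zero_lt_one fun i hi => ?_
  have hi0 : (i : ℕ) ≠ 0 := fun h => (Finset.mem_erase.1 hi).1 (Fin.ext h)
  rw [Algebra.smul_def, map_mul]
  refine mul_lt_one_of_nonneg_of_lt_one_right (hc i) zero_le ?_
  rw [map_pow, hϖ]
  exact pow_lt_one₀ zero_le (by rw [← exp_zero, exp_lt_exp]; norm_num) hi0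

/-- The group `Gal(L/K)` is a `p`-group, so its elements fix a uniformizer modulo `𝔓 ^ 2`. -/
theorem apply_uniformizer_sub_le {p n : ℕ} [Fact p.Prime] [CharP L p] [IsGalois K L]
    (hN : Module.finrank K L = p ^ n) {ϖ : L} (hϖ : v ϖ = exp (-1)) (σ : L ≃ₐ[K] L) :
    v (σ ϖ - ϖ) ≤ exp (-2) := by
  have hϖ0 : ϖ ≠ 0 := by
    rintro rfl
    rw [map_zero] at hϖ
    exact exp_ne_zero hϖ.symm
  have hu : v (σ ϖ / ϖ) = 1 := by
    rw [map_div₀, hv.apply_aut, div_self]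
    rw [hϖ]; exact exp_ne_zero
  obtain ⟨c, hc1, hc⟩ := hv.exists_base_sub_lt hu.le
  have hpow : ∀ i : ℕ, v ((σ ^ i) ϖ / ϖ - algebraMap K L c ^ i) < 1 := by
    intro i
    induction i with
    | zero => simp [hϖ0]
    | succ i ih =>
      have h1 : (σ ^ (i + 1)) ϖ / ϖ - algebraMap K L c ^ (i + 1) =
          σ ((σ ^ i) ϖ / ϖ - algebraMap K L c ^ i) * (σ ϖ / ϖ) +
          (σ ϖ / ϖ - algebraMap K L c) * algebraMap K L c ^ i := by
        have h2 : σ ϖ ≠ 0 := (map_ne_zero σ).2 hϖ0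
        rw [pow_succ' σ, AlgEquiv.mul_apply, map_sub, map_div₀, map_pow, AlgEquiv.commutes]
        field_simp
        ring
      rw [h1]
      refine Valuation.map_add_lt v ?_ ?_
      · rw [map_mul, hu, mul_one, hv.apply_aut]
        exact ih
      · rw [map_mul]
        refine mul_lt_one_of_lt_of_le hc ?_
        rw [map_pow]
        exact pow_le_one' hc1 i
  have h1 := hpow (p ^ n)
  have hσ : σ ^ (p ^ n) = 1 := by
    rw [← hN, ← IsGalois.card_aut_eq_finrank]
    exact pow_card_eq_one'
  rw [hσ, AlgEquiv.one_apply, div_self hϖ0] at h1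
  have h2 : v (1 - algebraMap K L c) < 1 := by
    rw [← one_pow (p ^ n), ← sub_pow_char_pow, map_pow] at h1
    by_contra h
    exact absurd h1 (not_lt.2 (one_le_pow_of_one_le' (not_lt.1 h) _))
  have h3 : v (σ ϖ / ϖ - 1) < 1 := by
    have : σ ϖ / ϖ - 1 = (σ ϖ / ϖ - algebraMap K L c) - (1 - algebraMap K L c) := by ring
    rw [this]
    exact Valuation.map_sub_lt v hc h2
  have h4 : σ ϖ - ϖ = (σ ϖ / ϖ - 1) * ϖ := by field_simp
  rw [h4, map_mul, hϖ]
  have h5 := mul_le_mul_left (lt_one_iff_le_exp.1 h3) (exp (-1 : ℤ))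
  rwa [← exp_add] at h5

/-- The second ramification group is trivial, so by the preceding bound every `σ ≠ 1` moves a
uniformizer by an element of valuation exactly `2`. -/
theorem apply_uniformizer_sub {p n : ℕ} [Fact p.Prime] [CharP L p] [IsGalois K L]
    (hN : Module.finrank K L = p ^ n) {ϖ : L} (hϖ : v ϖ = exp (-1)) {σ : L ≃ₐ[K] L} (hσ : σ ≠ 1) :
    v (σ ϖ - ϖ) = exp (-2) := by
  refine le_antisymm (hv.apply_uniformizer_sub_le hN hϖ σ) ?_
  obtain ⟨x, hx, hx3⟩ := hv.weak σ hσ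
  obtain ⟨c, hc, rfl⟩ := hv.exists_sum_pow hϖ hx
  have hle : v ϖ ≤ 1 := by rw [hϖ, ← exp_zero, exp_le_exp]; norm_num
  have h1 : v (σ (∑ i, c i • ϖ ^ (i : ℕ)) - ∑ i, c i • ϖ ^ (i : ℕ)) ≤ v (σ ϖ - ϖ) := by
    rw [map_sum, ← Finset.sum_sub_distrib]
    refine Valuation.map_sum_le v fun i _ => ?_
    rw [map_smul, map_pow, ← smul_sub, Algebra.smul_def, map_mul,
      ← (Commute.all (σ ϖ) ϖ).geom_sum₂_mul, map_mul]
    suffices h : v (∑ j ∈ Finset.range i, σ ϖ ^ j * ϖ ^ ((i : ℕ) - 1 - j)) ≤ 1 from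
      (mul_le_mul' (hc i) (mul_le_mul' h le_rfl)).trans (by simp)
    refine Valuation.map_sum_le v fun j _ => ?_
    rw [map_mul, map_pow, map_pow, hv.apply_aut]
    exact mul_le_one' (pow_le_one' hle _) (pow_le_one' hle _)
  have h2 := hx3.trans_le h1
  by_contra h3
  rw [not_le, lt_exp_iff] at h3
  exact absurd h2 (not_lt.2 h3)

end IsTotWeak
end Valuation

/-! ### A normal integral basis and vanishing of cohomology -/

section NormalBasis

open WithZero

variable {K L : Type*} [Field K] [Field L] [Algebra K L]
  {v : Valuation L ℤᵐ⁰} {p n : ℕ} [Fact p.Prime]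

/-- In characteristic `p`, the differences `a ↦ a (τ * ·) - a` for `τ` in a commutative `p`-group
are commuting nilpotent operators. Applying them as long as the result is not `triv`, one reaches a
function all of whose differences are `triv`. -/
theorem exists_invariant_of_not_triv {G K : Type*} [Group G] [Finite G] [Field K] [CharP K p]
    (hcomm : ∀ σ τ : G, σ * τ = τ * σ) (hG : Nat.card G = p ^ n)
    {good triv : (G → K) → Prop} (htriv0 : triv 0)
    (htriv : ∀ a τ, triv a → triv fun σ => a (τ * σ) - a σ)
    (hgood : ∀ a τ, good a → good fun σ => a (τ * σ) - a σ)
    {a : G → K} (ha : good a) (hat : ¬ triv a) :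
    ∃ b, good b ∧ ¬ triv b ∧ ∀ τ, triv fun σ => b (τ * σ) - b σ := by
  classical
  have := Fintype.ofFinite G
  let T : G → Module.End K (G → K) := fun τ => LinearMap.funLeft K K (τ * ·)
  let Δ : G → Module.End K (G → K) := fun τ => T τ - 1
  have hT : ∀ σ τ, Commute (T σ) (T τ) := fun σ τ => by
    refine LinearMap.ext fun a => funext fun ρ => ?_
    change a (τ * (σ * ρ)) = a (σ * (τ * ρ))
    rw [← mul_assoc τ, ← mul_assoc σ, hcomm τ σ]
  have hΔ : ∀ σ τ, Commute (Δ σ) (Δ τ) := fun σ τ =>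
    ((hT σ τ).sub_right (Commute.one_right _)).sub_left (Commute.one_left _)
  have hTpow : ∀ (τ : G) (i : ℕ) (a : G → K) (σ : G), (T τ ^ i) a σ = a (τ ^ i * σ) := by
    intro τ i
    induction i with
    | zero => intro a σ; simp
    | succ i ih =>
      intro a σ
      rw [pow_succ, Module.End.mul_apply, ih]
      change a (τ * (τ ^ i * σ)) = _
      rw [← mul_assoc, pow_succ']
  have hnil : ∀ τ, Δ τ ^ (p ^ n) = 0 := fun τ => by
    have : CharP (Module.End K (G → K)) p := charP_of_injective_algebraMap' K p
    rw [sub_pow_char_pow_of_commute _ _ (Commute.one_right _), one_pow, sub_eq_zero]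
    refine LinearMap.ext fun a => funext fun σ => ?_
    rw [hTpow, ← hG, pow_card_eq_one', one_mul]
    rfl
  have hgoodΔ : ∀ τ (i : ℕ) a, good a → good ((Δ τ ^ i) a) := by
    intro τ i
    induction i with
    | zero => exact fun a h => h
    | succ i ih =>
      intro a h
      rw [pow_succ', Module.End.mul_apply]
      exact hgood _ τ (ih a h)
  have htrivΔ : ∀ τ (i : ℕ) a, triv a → triv ((Δ τ ^ i) a) := by
    intro τ i
    induction i with
    | zero => exact fun a h => h
    | succ i ih =>
      intro a h
      rw [pow_succ', Module.End.mul_apply]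
      exact htriv _ τ (ih a h)
  have key : ∀ S : Finset G, ∃ b, good b ∧ ¬ triv b ∧ ∀ τ ∈ S, triv (Δ τ b) := by
    intro S
    induction S using Finset.induction with
    | empty => exact ⟨a, ha, hat, by simp⟩
    | insert τ S _ ih =>
      obtain ⟨b, hb, hbt, hbS⟩ := ih
      have hex : ∃ i, triv ((Δ τ ^ i) b) := ⟨p ^ n, by rw [hnil]; exact htriv0⟩
      obtain ⟨i, hi⟩ : ∃ i, Nat.find hex = i + 1 := Nat.exists_eq_add_one.2 (by
        rw [Nat.find_pos]
        exact hbt)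
      refine ⟨(Δ τ ^ i) b, hgoodΔ τ i b hb, Nat.find_min hex (by omega), fun ρ hρ => ?_⟩
      rcases Finset.mem_insert.1 hρ with rfl | hρ
      · have := Nat.find_spec hex
        rwa [hi, pow_succ', Module.End.mul_apply] at this
      · rw [← Module.End.mul_apply, ((hΔ ρ τ).pow_right i).eq, Module.End.mul_apply]
        exact htrivΔ τ i _ (hbS ρ hρ)
  obtain ⟨b, hb, hbt, h⟩ := key Finset.univ
  exact ⟨b, hb, hbt, fun τ => h τ (Finset.mem_univ τ)⟩

/-- An additive set of representatives for the residue field: an additive map of `K` that kills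
the maximal ideal and moves elements by elements of the maximal ideal only. -/
theorem exists_additive_representatives (v : Valuation L ℤᵐ⁰) (p : ℕ) [Fact p.Prime]
    [CharP L p] :
    ∃ f : K →+ K, (∀ c, v (algebraMap K L c) < 1 → f c = 0) ∧
      ∀ c, v (algebraMap K L (f c - c)) < 1 := by
  have : CharP K p := (algebraMap K L).charP (algebraMap K L).injective p
  let _ : Algebra (ZMod p) K := ZMod.algebra K p
  let W₀ : AddSubgroup K :=
    { carrier := {c | v (algebraMap K L c) < 1}
      zero_mem' := by simp
      add_mem' := fun {a b} ha hb => by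
        simp only [Set.mem_ofPred_eq] at ha hb ⊢
        rw [map_add]
        exact Valuation.map_add_lt v ha hb
      neg_mem' := fun {a} ha => by
        simp only [Set.mem_ofPred_eq] at ha ⊢
        rwa [map_neg, Valuation.map_neg] }
  let W : Submodule (ZMod p) K := AddSubgroup.toZModSubmodule p W₀
  obtain ⟨g, hg⟩ := W.subtype.exists_leftInverse_of_injective
    (LinearMap.ker_eq_bot.2 W.subtype_injective)
  refine ⟨(AddMonoidHom.id K) - (W.subtype.comp g).toAddMonoidHom, fun c hc => ?_, fun c => ?_⟩
  · have h := LinearMap.congr_fun hg ⟨c, hc⟩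
    change c - (g c : K) = 0
    have h' : g c = ⟨c, hc⟩ := h
    rw [h', sub_self]
  · change v (algebraMap K L (c - (g c : K) - c)) < 1
    rw [sub_sub_cancel_left, map_neg, Valuation.map_neg]
    exact (g c).2

variable [FiniteDimensional K L] [IsGalois K L] [CharP L p]

/-- An element of valuation `-1` that each `σ ≠ 1` moves by a unit. -/
theorem IsTotWeak.exists_inv_uniformizer (hv : IsTotWeak K v) (hN : Module.finrank K L = p ^ n) :
    ∃ z : L, v z = exp 1 ∧ ∀ σ : L ≃ₐ[K] L, σ ≠ 1 → v (σ z - z) = 1 := by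
  obtain ⟨ϖ, hϖ⟩ := hv.exists_uniformizer
  have hϖ0 : ϖ ≠ 0 := by
    rintro rfl
    rw [map_zero] at hϖ
    exact exp_ne_zero hϖ.symm
  refine ⟨ϖ⁻¹, by rw [map_inv₀, hϖ, ← exp_neg, neg_neg], fun σ hσ => ?_⟩
  have h0 : σ ϖ ≠ 0 := (map_ne_zero σ).2 hϖ0
  have h1 : σ ϖ⁻¹ - ϖ⁻¹ = -(σ ϖ - ϖ) / (σ ϖ * ϖ) := by
    rw [map_inv₀]
    field_simp
    ring
  rw [h1, map_div₀, Valuation.map_neg, hv.apply_uniformizer_sub hN hϖ hσ, map_mul, hv.apply_aut,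
    hϖ, ← exp_add]
  norm_num

/-- For the element `z` of `exists_inv_uniformizer`, the map sending `σ` to the residue class of
`σ z - z` embeds `Gal(L/K)` in the additive group of the residue field, so `Gal(L/K)` is
commutative. -/
theorem IsTotWeak.mul_comm (hv : IsTotWeak K v) (hN : Module.finrank K L = p ^ n)
    (σ τ : L ≃ₐ[K] L) : σ * τ = τ * σ := by
  obtain ⟨z, -, hz⟩ := hv.exists_inv_uniformizer hN
  by_contra hne
  have hle : ∀ σ : L ≃ₐ[K] L, v (σ z - z) ≤ 1 := fun σ => by
    rcases eq_or_ne σ 1 with rfl | h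
    · simp
    · exact (hz σ h).le
  -- `(σ - 1) (τ - 1) z` lies in the maximal ideal since `σ` is trivial on the residue field.
  have htriv : ∀ (σ : L ≃ₐ[K] L) (x : L), v x ≤ 1 → v (σ x - x) < 1 := fun σ x hx => by
    obtain ⟨c, -, hc⟩ := hv.exists_base_sub_lt hx
    have : σ x - x = σ (x - algebraMap K L c) - (x - algebraMap K L c) := by
      rw [map_sub, AlgEquiv.commutes]; ring
    rw [this]
    exact Valuation.map_sub_lt v (by rwa [hv.apply_aut]) hc
  have h1 : v ((σ * τ) z - (τ * σ) z) < 1 := by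
    have : (σ * τ) z - (τ * σ) z = (σ (τ z - z) - (τ z - z)) - (τ (σ z - z) - (σ z - z)) := by
      rw [AlgEquiv.mul_apply, AlgEquiv.mul_apply, map_sub, map_sub]; ring
    rw [this]
    exact Valuation.map_sub_lt v (htriv σ _ (hle τ)) (htriv τ _ (hle σ))
  have h2 : (σ * τ) z - (τ * σ) z = (τ * σ) (((τ * σ)⁻¹ * (σ * τ)) z - z) := by
    rw [map_sub, ← AlgEquiv.mul_apply (τ * σ), mul_inv_cancel_left]
  rw [h2, hv.apply_aut, hz] at h1
  · exact lt_irrefl _ h1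
  · rw [Ne, inv_mul_eq_one]
    exact fun h => hne h.symm

/-- Euler's formula for `∑ σ, σ (ϖ ^ i / f' ϖ)`, with `f` the minimal polynomial of a uniformizer
`ϖ` and `i = [L : K] - 1`, produces an element of trace `1` and valuation `1 - [L : K]`. -/
theorem IsTotWeak.exists_trace_one (hv : IsTotWeak K v) (hN : Module.finrank K L = p ^ n) :
    ∃ θ : L, v θ = exp (Module.finrank K L - 1 : ℤ) ∧ ∑ σ : L ≃ₐ[K] L, σ θ = 1 := by
  classical
  obtain ⟨ϖ, hϖ⟩ := hv.exists_uniformizer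
  have hcard : Fintype.card (L ≃ₐ[K] L) = Module.finrank K L := by
    rw [← Nat.card_eq_fintype_card, IsGalois.card_aut_eq_finrank]
  have hpos : 0 < Module.finrank K L := Module.finrank_pos
  have hinj : Function.Injective fun σ : L ≃ₐ[K] L => σ ϖ := by
    intro σ τ h
    by_contra hne
    have h1 : τ⁻¹ * σ ≠ 1 := by
      rw [Ne, inv_mul_eq_one]
      exact fun h => hne h.symm
    have h2 := hv.apply_uniformizer_sub hN hϖ h1
    have h3 : (τ⁻¹ * σ) ϖ = ϖ := by
      rw [AlgEquiv.mul_apply, show σ ϖ = τ ϖ from h, ← AlgEquiv.mul_apply, inv_mul_cancel,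
        AlgEquiv.one_apply]
    rw [h3, sub_self, map_zero] at h2
    exact exp_ne_zero h2.symm
  refine ⟨ϖ ^ (Module.finrank K L - 1) / ∏ τ ∈ Finset.univ.erase (1 : L ≃ₐ[K] L), (ϖ - τ ϖ),
    ?_, ?_⟩
  · have h1 : ∀ τ ∈ Finset.univ.erase (1 : L ≃ₐ[K] L), v (ϖ - τ ϖ) = exp (-2) := fun τ hτ => by
      rw [Valuation.map_sub_swap]
      exact hv.apply_uniformizer_sub hN hϖ (Finset.ne_of_mem_erase hτ)
    rw [map_div₀, map_prod, Finset.prod_congr rfl h1, Finset.prod_const,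
      Finset.card_erase_of_mem (Finset.mem_univ _), Finset.card_univ, hcard, map_pow, hϖ,
      ← exp_nsmul, ← exp_nsmul, ← exp_sub]
    congr 1
    simp only [nsmul_eq_mul]
    push_cast [Nat.cast_sub (show 1 ≤ Module.finrank K L from hpos)]
    ring
  · have h := Lagrange.coeff_eq_sum (s := (Finset.univ : Finset (L ≃ₐ[K] L)))
      (v := fun σ => σ ϖ) (hinj.injOn) (P := Polynomial.X ^ (Module.finrank K L - 1)) (by
        rw [Polynomial.degree_X_pow, Finset.card_univ, hcard]
        exact_mod_cast Nat.sub_lt hpos one_pos)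
    rw [Finset.card_univ, hcard, Polynomial.coeff_X_pow_self] at h
    rw [h]
    refine Finset.sum_congr rfl fun σ _ => ?_
    rw [map_div₀, map_pow, map_prod, Polynomial.eval_pow, Polynomial.eval_X]
    congr 1
    refine Finset.prod_nbij' (fun τ => σ * τ) (fun τ => σ⁻¹ * τ) ?_ ?_ ?_ ?_ ?_
    · intro τ hτ
      simpa using hτ
    · intro τ hτ
      simpa [inv_mul_eq_one, eq_comm] using hτ
    · intro τ _; simp
    · intro τ _; simp
    · intro τ _
      rw [map_sub, AlgEquiv.mul_apply]

/-- The conjugates of an element `θ` of trace `1` and valuation `1 - [L : K]` are an integral normal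
basis of sorts: the coefficients of an element with respect to them are bounded by its value. A
counterexample with integral coefficients, not all in the maximal ideal, could be moved by the
operators `τ - 1` to one whose coefficients are all congruent, which is a constant times the trace
of `θ` modulo the maximal ideal. -/
theorem IsTotWeak.coeff_le_apply_sum (hv : IsTotWeak K v) (hN : Module.finrank K L = p ^ n) {θ : L}
    (hθ : v θ = exp (Module.finrank K L - 1 : ℤ)) (htr : ∑ σ : L ≃ₐ[K] L, σ θ = 1)
    (a : (L ≃ₐ[K] L) → K) (σ : L ≃ₐ[K] L) :
    v (algebraMap K L (a σ)) ≤ v (∑ τ, a τ • τ θ) := by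
  have : CharP K p := (algebraMap K L).charP (algebraMap K L).injective p
  -- If `v (a τ) < 1` for all `τ`, the combination is small.
  have hsmall : ∀ a : (L ≃ₐ[K] L) → K, (∀ τ, v (algebraMap K L (a τ)) < 1) →
      v (∑ τ, a τ • τ θ) < 1 := fun a ha => by
    refine Valuation.map_sum_lt' v zero_lt_one fun τ _ => ?_
    rw [Algebra.smul_def, map_mul, hv.apply_aut, hθ, lt_one_iff_le_exp]
    refine (mul_le_mul' (hv.base_le_of_lt_one (ha τ)) le_rfl).trans ?_
    rw [← exp_add, exp_le_exp]
    omega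
  have hint : ∀ a : (L ≃ₐ[K] L) → K, (∀ τ, v (algebraMap K L (a τ)) ≤ 1) →
      v (∑ τ, a τ • τ θ) < 1 → ∀ τ, v (algebraMap K L (a τ)) < 1 := by
    intro a ha1 ha
    by_contra hcon
    obtain ⟨b, ⟨hb1, hb⟩, hbt, hbinv⟩ := exists_invariant_of_not_triv (p := p) (n := n)
      (G := L ≃ₐ[K] L) (K := K) (hv.mul_comm hN) (by rw [IsGalois.card_aut_eq_finrank, hN])
      (good := fun a => (∀ τ, v (algebraMap K L (a τ)) ≤ 1) ∧ v (∑ τ, a τ • τ θ) < 1)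
      (triv := fun a => ∀ τ, v (algebraMap K L (a τ)) < 1) (by simp)
      (fun a τ h σ => by
        rw [map_sub]
        exact Valuation.map_sub_lt v (h _) (h _))
      (fun a τ h => by
        refine ⟨fun σ => ?_, ?_⟩
        · rw [map_sub]
          exact Valuation.map_sub_le v (h.1 _) (h.1 _)
        · have h1 : ∑ σ, (a (τ * σ) - a σ) • σ θ = τ⁻¹ (∑ σ, a σ • σ θ) - ∑ σ, a σ • σ θ := by
            simp_rw [sub_smul]
            rw [Finset.sum_sub_distrib, map_sum]
            congr 1
            refine Fintype.sum_equiv (Equiv.mulLeft τ) _ _ fun σ => ?_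
            rw [Equiv.coe_mulLeft, map_smul, ← AlgEquiv.mul_apply, inv_mul_cancel_left]
          rw [h1]
          exact Valuation.map_sub_lt v (by rw [hv.apply_aut]; exact h.2) h.2) ⟨ha1, ha⟩ hcon
    -- All `b σ` agree with `b 1`, so the combination is `b 1` times the trace of `θ`.
    have hb2 : ∀ σ, v (algebraMap K L (b σ - b 1)) < 1 := fun σ => by
      simpa using hbinv σ 1
    have h1 : algebraMap K L (b 1) = ∑ τ, b τ • τ θ - ∑ τ, (b τ - b 1) • τ θ := by
      simp_rw [sub_smul]
      rw [Finset.sum_sub_distrib, ← Finset.smul_sum, htr, sub_sub_cancel,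
        Algebra.algebraMap_eq_smul_one]
    have h2 : v (algebraMap K L (b 1)) < 1 := by
      rw [h1]
      exact Valuation.map_sub_lt v hb (hsmall _ hb2)
    refine hbt fun σ => ?_
    have h3 : b σ = b 1 + (b σ - b 1) := by ring
    rw [h3, map_add]
    exact Valuation.map_add_lt v h2 (hb2 σ)
  obtain ⟨m, -, hm⟩ := Finset.exists_max_image Finset.univ
    (fun τ => v (algebraMap K L (a τ))) ⟨σ, by simp⟩
  refine (hm σ (Finset.mem_univ σ)).trans ?_
  rcases eq_or_ne (a m) 0 with h0 | h0
  · rw [h0, map_zero, map_zero]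
    exact zero_le
  -- Normalise the largest coefficient to `1`.
  have hm0 : v (algebraMap K L (a m)) ≠ 0 := by simpa using h0
  have hpos : 0 < v (algebraMap K L (a m)) := zero_lt_iff.2 hm0
  by_contra hcon
  rw [not_le] at hcon
  have h1 := hint (fun τ => (a m)⁻¹ * a τ) (fun τ => by
      rw [map_mul, map_mul, map_inv₀, map_inv₀]
      exact inv_mul_le_one_of_le₀ (hm τ (Finset.mem_univ τ)) zero_le) (by
      simp_rw [mul_smul]
      rw [← Finset.smul_sum, Algebra.smul_def, map_mul, map_inv₀, map_inv₀]
      exact (inv_mul_lt_one₀ hpos).2 hcon) m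
  simp [h0] at h1

/-- Vanishing of `H^1(Gal(L/K), 𝔓)`, in the form needed: an element moved into `𝔓` by all
`σ - 1` lies in `K + 𝔓`. -/
theorem IsTotWeak.exists_sub_base_lt (hv : IsTotWeak K v) (hN : Module.finrank K L = p ^ n) {u : L}
    (hu : ∀ σ : L ≃ₐ[K] L, v (σ u - u) < 1) : ∃ c : K, v (u - algebraMap K L c) < 1 := by
  obtain ⟨θ, hθ, htr⟩ := hv.exists_trace_one hN
  have hcard : Fintype.card (L ≃ₐ[K] L) = Module.finrank K L := by
    rw [← Nat.card_eq_fintype_card, IsGalois.card_aut_eq_finrank]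
  have hli : LinearIndependent K fun σ : L ≃ₐ[K] L => σ θ := by
    rw [Fintype.linearIndependent_iff]
    intro a ha σ
    have h := hv.coeff_le_apply_sum hN hθ htr a σ
    rw [ha, map_zero, le_zero_iff] at h
    simpa using h
  have : Nonempty (L ≃ₐ[K] L) := ⟨1⟩
  let B := basisOfLinearIndependentOfCardEqFinrank hli hcard
  have hB : ∀ σ, B σ = σ θ := fun σ => by simp [B]
  set a := B.repr u with ha
  have hsum : u = ∑ σ, a σ • σ θ := by
    simp_rw [← hB]
    exact (B.sum_repr u).symm
  have hdiff : ∀ τ : L ≃ₐ[K] L, v (algebraMap K L (a τ - a 1)) < 1 := fun τ => by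
    have h1 : τ⁻¹ u - u = ∑ σ, (a (τ * σ) - a σ) • σ θ := by
      simp_rw [sub_smul]
      rw [Finset.sum_sub_distrib, ← hsum]
      congr 1
      conv_lhs => rw [hsum]
      rw [map_sum]
      symm
      refine Fintype.sum_equiv (Equiv.mulLeft τ) _ _ fun σ => ?_
      rw [Equiv.coe_mulLeft, map_smul, ← AlgEquiv.mul_apply, inv_mul_cancel_left]
    have h2 := hv.coeff_le_apply_sum hN hθ htr (fun σ => a (τ * σ) - a σ) 1
    rw [← h1, mul_one] at h2
    exact h2.trans_lt (hu τ⁻¹)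
  refine ⟨a 1, ?_⟩
  have h1 : u - algebraMap K L (a 1) = ∑ σ, (a σ - a 1) • σ θ := by
    simp_rw [sub_smul]
    rw [Finset.sum_sub_distrib, ← Finset.smul_sum, htr, ← hsum, Algebra.algebraMap_eq_smul_one]
  rw [h1]
  refine Valuation.map_sum_lt' v zero_lt_one fun τ _ => ?_
  rw [Algebra.smul_def, map_mul, hv.apply_aut, hθ, lt_one_iff_le_exp]
  refine (mul_le_mul' (hv.base_le_of_lt_one (hdiff τ)) le_rfl).trans ?_
  rw [← exp_add, exp_le_exp]
  omega

/-- A weakly and totally ramified `p`-extension in characteristic `p` is generated by an element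
`y` of valuation `-1` on which the Galois group acts by translations by elements of `K`.

For `z` as in `exists_inv_uniformizer`, an additive choice of representatives in `K` for the residue
classes of `σ z - z` is a homomorphism from the Galois group to `K`. As `H^1(Gal(L/K), L) = 0`, some
`y₀` is translated by it, and `y₀ - z` lies in `K + 𝔓` by `exists_sub_base_lt`. -/
theorem IsTotWeak.exists_translation (hv : IsTotWeak K v) (hN : Module.finrank K L = p ^ n) :
    ∃ (y : L) (α : (L ≃ₐ[K] L) → K), v y = exp 1 ∧ Function.Injective α ∧
      ∀ σ, σ y = y + algebraMap K L (α σ) := by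
  obtain ⟨z, hz, hz1⟩ := hv.exists_inv_uniformizer hN
  obtain ⟨θ, -, htr⟩ := hv.exists_trace_one hN
  obtain ⟨f, hf0, hf⟩ := exists_additive_representatives (K := K) v p
  have hle : ∀ σ : L ≃ₐ[K] L, v (σ z - z) ≤ 1 := fun σ => by
    rcases eq_or_ne σ 1 with rfl | h
    · simp
    · exact (hz1 σ h).le
  choose a _ ha using fun σ => hv.exists_base_sub_lt (hle σ)
  have happrox : ∀ σ, v (σ z - z - algebraMap K L (f (a σ))) < 1 := fun σ => by
    have : σ z - z - algebraMap K L (f (a σ)) =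
        (σ z - z - algebraMap K L (a σ)) - algebraMap K L (f (a σ) - a σ) := by
      rw [map_sub]; ring
    rw [this]
    exact Valuation.map_sub_lt v (ha σ) (hf _)
  have hadd : ∀ σ τ, f (a (σ * τ)) = f (a σ) + f (a τ) := fun σ τ => by
    have h1 : f (a (σ * τ) - a σ - a τ) = 0 := by
      refine hf0 _ ?_
      have h2 : algebraMap K L (a (σ * τ) - a σ - a τ) =
          σ (τ z - z - algebraMap K L (a τ)) + (σ z - z - algebraMap K L (a σ)) -
          ((σ * τ) z - z - algebraMap K L (a (σ * τ))) := by
        simp only [map_sub, AlgEquiv.commutes, AlgEquiv.mul_apply]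
        ring
      rw [h2]
      exact Valuation.map_sub_lt v
        (Valuation.map_add_lt v (by rw [hv.apply_aut]; exact ha τ) (ha σ)) (ha _)
    rw [map_sub, map_sub] at h1
    linear_combination h1
  -- `y₀` has the right translations; it is corrected by an element of `K`.
  set y₀ : L := -∑ σ, f (a σ) • σ θ with hy₀
  have hy₀σ : ∀ τ : L ≃ₐ[K] L, τ y₀ = y₀ + algebraMap K L (f (a τ)) := fun τ => by
    have h1 : τ (∑ σ, f (a σ) • σ θ) = ∑ σ, (f (a σ) - f (a τ)) • σ θ := by
      rw [map_sum]
      refine Fintype.sum_equiv (Equiv.mulLeft τ) _ _ fun σ => ?_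
      rw [Equiv.coe_mulLeft, map_smul, ← AlgEquiv.mul_apply, hadd, add_sub_cancel_left]
    rw [hy₀, map_neg, h1]
    simp_rw [sub_smul]
    rw [Finset.sum_sub_distrib, ← Finset.smul_sum, htr, Algebra.algebraMap_eq_smul_one]
    ring
  obtain ⟨c, hc⟩ := hv.exists_sub_base_lt hN (u := y₀ - z) fun σ => by
    have : σ (y₀ - z) - (y₀ - z) = -(σ z - z - algebraMap K L (f (a σ))) := by
      rw [map_sub, hy₀σ]; ring
    rw [this, Valuation.map_neg]
    exact happrox σ
  refine ⟨y₀ - algebraMap K L c, fun σ => f (a σ), ?_, fun σ τ h => ?_, fun σ => ?_⟩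
  · rw [← hz]
    refine Valuation.map_eq_of_sub_lt v ?_
    rw [sub_right_comm, hz]
    refine hc.trans ?_
    rw [← exp_zero, exp_lt_exp]
    norm_num
  · by_contra hne
    have h0 : f (a 1) = 0 := by
      have := hadd 1 1
      rw [mul_one] at this
      linear_combination -this
    have h1 : f (a (τ⁻¹ * σ)) = 0 := by
      have h2 := hadd τ (τ⁻¹ * σ)
      rw [mul_inv_cancel_left] at h2
      change f (a σ) = f (a τ) at h
      linear_combination h - h2
    have h2 := happrox (τ⁻¹ * σ)
    rw [h1, map_zero, sub_zero, hz1] at h2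
    · exact lt_irrefl _ h2
    · rw [Ne, inv_mul_eq_one]
      exact fun h => hne h.symm
  · rw [map_sub, AlgEquiv.commutes, hy₀σ]
    ring

end NormalBasis

/-! ### The normalised valuation of the extension field -/

section NormalizedValuation

open WithZero

section DVR

variable (OL L : Type*) [CommRing OL] [IsDomain OL] [IsDiscreteValuationRing OL]
  [Field L] [Algebra OL L] [IsFractionRing OL L]

/-- The normalised valuation of the fraction field of a discrete valuation ring, written
multiplicatively: uniformizers have value `exp (-1)`. -/
noncomputable def normVal : Valuation L ℤᵐ⁰ :=
  (IsDiscreteValuationRing.maximalIdeal OL).valuation L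

variable {OL L}

theorem normVal_le_one_iff {x : L} : normVal OL L x ≤ 1 ↔ ∃ z : OL, algebraMap OL L z = x :=
  ⟨IsDiscreteValuationRing.exists_lift_of_le_one, by
    rintro ⟨z, rfl⟩
    exact IsDedekindDomain.HeightOneSpectrum.valuation_le_one _ z⟩

theorem normVal_irreducible {ϖ : OL} (h : Irreducible ϖ) :
    normVal OL L (algebraMap OL L ϖ) = exp (-1) := by
  rw [normVal, IsDedekindDomain.HeightOneSpectrum.valuation_of_algebraMap]
  exact IsDedekindDomain.HeightOneSpectrum.intValuation_singleton _ h.ne_zero h.maximalIdeal_eq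

theorem normVal_unit {u : OL} (h : IsUnit u) : normVal OL L (algebraMap OL L u) = 1 := by
  obtain ⟨u, rfl⟩ := h
  refine le_antisymm (normVal_le_one_iff.2 ⟨_, rfl⟩) ?_
  have h1 : normVal OL L (algebraMap OL L ↑u⁻¹) ≤ 1 := normVal_le_one_iff.2 ⟨_, rfl⟩
  have h2 : normVal OL L (algebraMap OL L u) * normVal OL L (algebraMap OL L ↑u⁻¹) = 1 := by
    rw [← map_mul, ← map_mul, Units.mul_inv, map_one, map_one]
  rw [← h2]
  exact mul_le_of_le_one_right' h1

theorem normVal_le_exp_neg_iff {z : OL} {i : ℕ} :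
    normVal OL L (algebraMap OL L z) ≤ exp (-(i : ℤ)) ↔ z ∈ maximalIdeal OL ^ i := by
  rw [normVal, IsDedekindDomain.HeightOneSpectrum.valuation_of_algebraMap]
  exact IsDedekindDomain.HeightOneSpectrum.intValuation_le_pow_iff_mem _ z i

theorem mem_idealPow_iff {OK : Type*} [CommRing OK] [Algebra OK L] [Algebra OK OL]
    [IsScalarTower OK OL L] {h : ℤ} {x : L} :
    x ∈ idealPow OK OL L h ↔ normVal OL L x ≤ exp (-h) := by
  obtain ⟨ϖ, hϖ⟩ := IsDiscreteValuationRing.exists_irreducible OL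
  have h0 : algebraMap OL L ϖ ≠ 0 := by simpa using hϖ.ne_zero
  have hpow : ((maximalIdeal OL : FractionalIdeal OL⁰ L) ^ h : FractionalIdeal OL⁰ L) =
      FractionalIdeal.spanSingleton OL⁰ (algebraMap OL L ϖ ^ h) := by
    rw [hϖ.maximalIdeal_eq, FractionalIdeal.coeIdeal_span_singleton]
    rcases h with i | i
    · rw [Int.ofNat_eq_natCast, zpow_natCast, zpow_natCast, FractionalIdeal.spanSingleton_pow]
    · rw [zpow_negSucc, zpow_negSucc, FractionalIdeal.spanSingleton_pow,
        FractionalIdeal.spanSingleton_inv]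
  have hval : normVal OL L (algebraMap OL L ϖ ^ h) = exp (-h) := by
    rw [map_zpow₀, normVal_irreducible hϖ, ← exp_zsmul]
    simp
  have hne : algebraMap OL L ϖ ^ h ≠ 0 := zpow_ne_zero _ h0
  change x ∈ ((maximalIdeal OL : FractionalIdeal OL⁰ L) ^ h : FractionalIdeal OL⁰ L) ↔ _
  rw [hpow, FractionalIdeal.mem_spanSingleton]
  have h1 : (∃ z : OL, z • algebraMap OL L ϖ ^ h = x) ↔
      ∃ z : OL, algebraMap OL L z = x / algebraMap OL L ϖ ^ h := by
    refine exists_congr fun z => ?_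
    rw [Algebra.smul_def, eq_div_iff hne]
  rw [h1, ← normVal_le_one_iff, map_div₀, hval, div_le_one₀ exp_pos]

end DVR

section Galois

variable (OK : Type*) {K OL L : Type*} [CommRing OK] [Field K] [Algebra OK K] [IsFractionRing OK K]
  [CommRing OL] [IsDomain OL] [IsDiscreteValuationRing OL]
  [Field L] [Algebra OL L] [IsFractionRing OL L]
  [Algebra K L] [Algebra OK L] [IsScalarTower OK K L] [FiniteDimensional K L]
  [Algebra OK OL] [IsScalarTower OK OL L] [IsIntegralClosure OL OK L]

include OK

theorem normVal_aut_le_one (σ : L ≃ₐ[K] L) {x : L} (hx : normVal OL L x ≤ 1) :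
    normVal OL L (σ x) ≤ 1 := by
  obtain ⟨z, rfl⟩ := normVal_le_one_iff.1 hx
  exact normVal_le_one_iff.2 ⟨galRestrict OK K L OL σ z, algebraMap_galRestrict_apply OK σ z⟩

theorem normVal_aut (σ : L ≃ₐ[K] L) (x : L) : normVal OL L (σ x) = normVal OL L x := by
  have hone : ∀ (σ : L ≃ₐ[K] L) (x : L), normVal OL L x = 1 → normVal OL L (σ x) = 1 := by
    intro σ x hx
    have hx0 : x ≠ 0 := by
      rintro rfl
      simp at hx
    refine le_antisymm (normVal_aut_le_one OK σ hx.le) ?_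
    have h1 := normVal_aut_le_one OK (OL := OL) σ (x := x⁻¹) (by rw [map_inv₀, hx, inv_one])
    rw [map_inv₀, map_inv₀] at h1
    have h2 : 0 < normVal OL L (σ x) := by
      rw [zero_lt_iff]
      simpa using hx0
    exact (inv_le_one₀ h2).1 h1
  obtain ⟨ϖ, hϖ⟩ := IsDiscreteValuationRing.exists_irreducible OL
  have hσϖ : normVal OL L (σ (algebraMap OL L ϖ)) = exp (-1) := by
    rw [← algebraMap_galRestrict_apply OK σ ϖ]
    exact normVal_irreducible ((MulEquiv.irreducible_iff (galRestrict OK K L OL σ)).2 hϖ)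
  rcases eq_or_ne x 0 with rfl | hx
  · rw [map_zero]
  have hx0 : normVal OL L x ≠ 0 := by simpa using hx
  obtain ⟨i, hi⟩ : ∃ i : ℤ, normVal OL L x = exp i := by
    lift normVal OL L x to ℤ using hx0 with i
    exact ⟨i, rfl⟩
  have h1 : normVal OL L (x * algebraMap OL L ϖ ^ i) = 1 := by
    rw [map_mul, map_zpow₀, normVal_irreducible hϖ, hi, ← exp_zsmul, ← exp_add]
    simp
  have h2 := hone σ _ h1
  rw [map_mul, map_zpow₀, map_mul, map_zpow₀, hσϖ] at h2
  rw [map_mul, map_zpow₀, normVal_irreducible hϖ] at h1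
  have h3 : (exp (-1) : ℤᵐ⁰) ^ i ≠ 0 := zpow_ne_zero _ exp_ne_zero
  exact mul_right_cancel₀ h3 (h2.trans h1.symm)

end Galois

variable {OK K OL L : Type*} [CommRing OK] [IsDomain OK] [IsDiscreteValuationRing OK]
  [Field K] [CommRing OL] [IsDomain OL] [IsDiscreteValuationRing OL]
  [Field L] [Algebra OL L] [IsFractionRing OL L]
  [Algebra K L] [Algebra OK L] [Algebra OK OL] [IsScalarTower OK OL L]

theorem normVal_base_irreducible (htot : IsTotallyRamified OK K OL L) {t : OK}
    (ht : Irreducible t) :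
    normVal OL L (algebraMap OK L t) = exp (-(Module.finrank K L : ℤ)) := by
  obtain ⟨ϖ, hϖ⟩ := IsDiscreteValuationRing.exists_irreducible OL
  have h1 : Associated (algebraMap OK OL t) (ϖ ^ Module.finrank K L) := by
    rw [← Ideal.span_singleton_eq_span_singleton, ← Ideal.span_singleton_pow,
      ← hϖ.maximalIdeal_eq, ← htot, ht.maximalIdeal_eq, Ideal.map_span, Set.image_singleton]
  obtain ⟨u, hu⟩ := h1
  rw [IsScalarTower.algebraMap_apply OK OL L]
  have h2 : normVal OL L (algebraMap OL L (algebraMap OK OL t * u)) =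
      normVal OL L (algebraMap OL L (algebraMap OK OL t)) := by
    rw [map_mul, map_mul, normVal_unit u.isUnit, mul_one]
  rw [← h2, hu, map_pow, map_pow, normVal_irreducible hϖ, ← exp_nsmul]
  simp

variable [Algebra OK K] [IsFractionRing OK K] [IsScalarTower OK K L]

theorem exists_zpow_normVal (htot : IsTotallyRamified OK K OL L) {t : OK}
    (ht : Irreducible t) {c : K} (hc : c ≠ 0) :
    ∃ (j : ℤ) (u : OKˣ), c = u • algebraMap OK K t ^ j ∧
      normVal OL L (algebraMap K L c) = exp (-(Module.finrank K L * j : ℤ)) := by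
  obtain ⟨j, u, hju⟩ := IsDiscreteValuationRing.exists_units_eq_smul_zpow_of_irreducible ht hc
  refine ⟨j, u, hju, ?_⟩
  have hu : normVal OL L (algebraMap OK L u) = 1 := by
    rw [IsScalarTower.algebraMap_apply OK OL L]
    exact normVal_unit (u.isUnit.map _)
  rw [hju, Units.smul_def, Algebra.smul_def, map_mul, map_mul, map_zpow₀, map_zpow₀,
    ← IsScalarTower.algebraMap_apply OK K L, ← IsScalarTower.algebraMap_apply OK K L, hu, one_mul,
    normVal_base_irreducible htot ht, ← exp_zsmul]
  congr 1
  simp only [smul_eq_mul]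
  ring

variable [FiniteDimensional K L]

theorem normVal_base_le_one_iff (htot : IsTotallyRamified OK K OL L) {c : K} :
    normVal OL L (algebraMap K L c) ≤ 1 ↔ c ∈ Set.range (algebraMap OK K) := by
  constructor
  · intro h
    rcases eq_or_ne c 0 with rfl | hc
    · exact ⟨0, map_zero _⟩
    obtain ⟨t, ht⟩ := IsDiscreteValuationRing.exists_irreducible OK
    obtain ⟨j, u, rfl, hj⟩ := exists_zpow_normVal (OL := OL) (L := L) htot ht hc
    rw [hj, ← exp_zero, exp_le_exp] at h
    have hpos : (0 : ℤ) < Module.finrank K L := mod_cast Module.finrank_pos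
    have hj0 : 0 ≤ j := by
      by_contra hcon
      have := mul_neg_of_pos_of_neg hpos (not_le.1 hcon)
      omega
    lift j to ℕ using hj0
    exact ⟨u * t ^ j, by simp [Units.smul_def, Algebra.smul_def]⟩
  · rintro ⟨r, rfl⟩
    rw [← IsScalarTower.algebraMap_apply, IsScalarTower.algebraMap_apply OK OL L]
    exact normVal_le_one_iff.2 ⟨_, rfl⟩

theorem isTotWeak_normVal [IsIntegralClosure OL OK L] (htot : IsTotallyRamified OK K OL L)
    (hweak : IsWeaklyRamified OK K OL L) : IsTotWeak K (normVal OL L) where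
  exists_uniformizer := by
    obtain ⟨ϖ, hϖ⟩ := IsDiscreteValuationRing.exists_irreducible OL
    exact ⟨_, normVal_irreducible hϖ⟩
  apply_aut := normVal_aut OK
  base c hc := by
    obtain ⟨t, ht⟩ := IsDiscreteValuationRing.exists_irreducible OK
    obtain ⟨j, -, -, hj⟩ := exists_zpow_normVal (OL := OL) (L := L) htot ht hc
    exact ⟨-j, by rw [hj, mul_neg]⟩
  weak σ hσ := by
    by_contra hcon
    refine hσ ?_
    rw [← Subgroup.mem_bot, ← hweak, mem_ramificationGroup]
    intro x
    have hx : normVal OL L (algebraMap OL L x) ≤ 1 := normVal_le_one_iff.2 ⟨x, rfl⟩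
    have h1 : normVal OL L (σ (algebraMap OL L x) - algebraMap OL L x) ≤
        exp (-((2 + 1 : ℕ) : ℤ)) := by
      by_contra h
      exact hcon ⟨_, hx, not_le.1 h⟩
    obtain ⟨y, hy⟩ := normVal_le_one_iff.1 (h1.trans (by rw [← exp_zero, exp_le_exp]; norm_num))
    rw [← hy, normVal_le_exp_neg_iff] at h1
    exact ⟨y, h1, hy⟩

end NormalizedValuation

/-! ### Hasse derivatives in the group algebra -/

section Hasse

variable {K L : Type*} [Field K] [Field L] [Algebra K L]

/-- Elements `D_s` of the group algebra act on the powers `y ^ a`, `a < N`, as Hasse derivatives: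
`D_s y ^ a = choose a s * y ^ (a - s)`. -/
def ActsAsHasse {N : ℕ} (y : L) (D : Fin N → MonoidAlgebra K (L ≃ₐ[K] L)) : Prop :=
  ∀ (s : Fin N) (a : ℕ), a < N →
    groupAlgebraAction K L (D s) (y ^ a) = ((a.choose s : ℕ) : K) • y ^ (a - s)

/-- If the Galois group translates `y` by distinct elements `α σ` of `K`, the expansion
`σ (y ^ a) = ∑ s, α σ ^ s * (choose a s * y ^ (a - s))` is inverted by the Vandermonde matrix of
the `α σ`. -/
theorem exists_actsAsHasse [FiniteDimensional K L] [IsGalois K L] {y : L} {α : (L ≃ₐ[K] L) → K}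
    {N : ℕ} (hN : Module.finrank K L = N) (hα : Function.Injective α)
    (hy : ∀ σ : L ≃ₐ[K] L, σ y = y + algebraMap K L (α σ)) :
    ∃ D : Fin N → MonoidAlgebra K (L ≃ₐ[K] L), ActsAsHasse y D := by
  classical
  have hcard : Fintype.card (L ≃ₐ[K] L) = N := by
    rw [← Nat.card_eq_fintype_card, IsGalois.card_aut_eq_finrank, hN]
  let e : Fin N ≃ (L ≃ₐ[K] L) := (Fintype.equivFinOfCardEq hcard).symm
  let V : Matrix (Fin N) (Fin N) K := Matrix.vandermonde fun i => α (e i)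
  have hV : V⁻¹ * V = 1 := Matrix.nonsing_inv_mul _ (isUnit_iff_ne_zero.2
    (Matrix.det_vandermonde_ne_zero_iff.2 (hα.comp e.injective)))
  refine ⟨fun s => ∑ i, MonoidAlgebra.single (e i) (V⁻¹ s i), fun s a ha => ?_⟩
  have hexp : ∀ i, (e i) (y ^ a) =
      ∑ r : Fin N, (V i r * ((a.choose r : ℕ) : K)) • y ^ (a - r) := by
    intro i
    have hr : ∑ r : Fin N, (V i r * ((a.choose r : ℕ) : K)) • y ^ (a - r) =
        ∑ r ∈ Finset.range N, (α (e i) ^ r * ((a.choose r : ℕ) : K)) • y ^ (a - r) :=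
      (Finset.sum_range fun r => (α (e i) ^ r * ((a.choose r : ℕ) : K)) • y ^ (a - r)).symm
    rw [hr, map_pow, hy, add_comm, add_pow]
    rw [← Finset.sum_subset (Finset.range_subset_range.2 (show a + 1 ≤ N from ha))]
    · refine Finset.sum_congr rfl fun r _ => ?_
      rw [Algebra.smul_def, map_mul, map_pow, map_natCast]
      ring
    · intro r _ hr
      rw [Finset.mem_range, not_lt] at hr
      rw [Nat.choose_eq_zero_of_lt (by omega), Nat.cast_zero, mul_zero, zero_smul]
  simp only [map_sum, LinearMap.sum_apply, groupAlgebraAction_single, hexp, Finset.smul_sum,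
    smul_smul]
  rw [Finset.sum_comm]
  have hcol : ∀ r, ∑ i, V⁻¹ s i * V i r = if s = r then 1 else 0 := fun r => by
    rw [← Matrix.mul_apply, hV, Matrix.one_apply]
  simp_rw [← Finset.sum_smul, ← mul_assoc, ← Finset.sum_mul, hcol]
  simp

variable {p n : ℕ} {y : L} {B : Module.Basis (Fin (p ^ n)) K L}
  (hB : ∀ a, B a = y ^ (a : ℕ)) {D : Fin (p ^ n) → MonoidAlgebra K (L ≃ₐ[K] L)}
  (hD : ActsAsHasse y D)

include hB hD

/-- The image of `y ^ a` determines the coefficients at all `D_s` with `s ≤ a` and `choose a s ≠ 0`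
in `K`. -/
theorem ActsAsHasse.sum_apply (c : Fin (p ^ n) → K) {a : ℕ} (ha : a < p ^ n) (s : Fin (p ^ n))
    (hs : (s : ℕ) ≤ a) :
    B.repr (groupAlgebraAction K L (∑ r, c r • D r) (y ^ a)) ⟨a - s, by omega⟩ =
      c s * ((a.choose s : ℕ) : K) := by
  rw [map_sum, LinearMap.sum_apply, map_sum, Finsupp.finsetSum_apply, Finset.sum_eq_single s]
  · rw [map_smul, LinearMap.smul_apply, hD s a ha, map_smul, map_smul]
    have : y ^ (a - (s : ℕ)) = B ⟨a - s, by omega⟩ := (hB ⟨a - s, _⟩).symm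
    rw [this, B.repr_self]
    simp
  · intro r _ hr
    rw [map_smul, LinearMap.smul_apply, hD r a ha, map_smul, map_smul]
    have : y ^ (a - (r : ℕ)) = B ⟨a - r, by omega⟩ := (hB ⟨a - r, _⟩).symm
    rw [this, B.repr_self]
    by_cases har : a < r
    · rw [Nat.choose_eq_zero_of_lt har]
      simp
    · have hne : (⟨a - r, by omega⟩ : Fin (p ^ n)) ≠ ⟨a - s, by omega⟩ := fun h => by
        rw [Fin.mk.injEq] at h
        exact hr (Fin.ext (by omega))
      simp [Finsupp.single_eq_of_ne' hne]
  · simp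

variable [Fact p.Prime] [CharP K p]

/-- The Hasse derivatives are linearly independent, even after evaluation at
`y ^ (p ^ n - 1)`. -/
theorem ActsAsHasse.linearIndependent : LinearIndependent K D := by
  rw [Fintype.linearIndependent_iff]
  intro c hc s
  have hpos : 0 < p ^ n := pow_pos (Fact.out : p.Prime).pos n
  have h := hD.sum_apply hB c (a := p ^ n - 1) (by omega) s (by omega)
  rw [hc, map_zero, LinearMap.zero_apply, map_zero, Finsupp.zero_apply] at h
  refine (mul_eq_zero.1 h.symm).resolve_right fun h0 => ?_
  rw [CharP.cast_eq_zero_iff K p] at h0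
  exact not_dvd_choose_pow_sub_one (p := p) s.2 h0

variable [FiniteDimensional K L] [IsGalois K L]

theorem ActsAsHasse.exists_basis :
    ∃ b : Module.Basis (Fin (p ^ n)) K (MonoidAlgebra K (L ≃ₐ[K] L)), ∀ s, b s = D s := by
  have hpos : 0 < p ^ n := pow_pos (Fact.out : p.Prime).pos n
  have : Nonempty (Fin (p ^ n)) := ⟨⟨0, hpos⟩⟩
  have hrank : Fintype.card (Fin (p ^ n)) = Module.finrank K (MonoidAlgebra K (L ≃ₐ[K] L)) := by
    rw [(MonoidAlgebra.coeffLinearEquiv K).finrank_eq, Module.finrank_finsupp_self,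
      ← Nat.card_eq_fintype_card (α := L ≃ₐ[K] L), IsGalois.card_aut_eq_finrank,
      Module.finrank_eq_card_basis B]
  exact ⟨basisOfLinearIndependentOfCardEqFinrank (hD.linearIndependent hB) hrank, fun s => by simp⟩

theorem ActsAsHasse.eq_of_apply_eq {x z : MonoidAlgebra K (L ≃ₐ[K] L)}
    (h : ∀ a < p ^ n, groupAlgebraAction K L x (y ^ a) = groupAlgebraAction K L z (y ^ a)) :
    x = z := by
  obtain ⟨b, hb⟩ := hD.exists_basis hB
  have hpos : 0 < p ^ n := pow_pos (Fact.out : p.Prime).pos n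
  have h1 : ∀ x (s : Fin (p ^ n)),
      B.repr (groupAlgebraAction K L x (y ^ (p ^ n - 1))) ⟨p ^ n - 1 - s, by omega⟩ =
        b.repr x s * (((p ^ n - 1).choose s : ℕ) : K) := fun x s => by
    have := hD.sum_apply hB (b.repr x) (a := p ^ n - 1) (by omega) s (by omega)
    simp_rw [← hb] at this
    rwa [b.sum_repr] at this
  refine b.ext_elem fun s => ?_
  have h2 : (((p ^ n - 1).choose s : ℕ) : K) ≠ 0 := by
    rw [Ne, CharP.cast_eq_zero_iff K p]
    exact not_dvd_choose_pow_sub_one (p := p) s.2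
  refine mul_right_cancel₀ h2 ?_
  rw [← h1, ← h1, h _ (by omega)]

/-- The Hasse derivatives multiply like divided powers. -/
theorem ActsAsHasse.mul (s r : Fin (p ^ n)) : D s * D r =
    if h : (s : ℕ) + r < p ^ n then (((s + r : ℕ).choose s : ℕ) : K) • D ⟨s + r, h⟩ else 0 := by
  refine hD.eq_of_apply_eq hB fun a ha => ?_
  rw [map_mul, Module.End.mul_apply, hD r a ha, map_smul, hD s _ (by omega), smul_smul]
  by_cases hsr : (s : ℕ) + r ≤ a
  · rw [dif_pos (by omega), map_smul, LinearMap.smul_apply, hD ⟨s + r, by omega⟩ a ha, smul_smul]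
    have h1 := Nat.choose_mul (n := a) (k := s + r) (s := r) (by omega)
    rw [Nat.add_sub_cancel, ← Nat.choose_symm_add] at h1
    rw [← Nat.cast_mul, ← Nat.cast_mul, mul_comm ((s + r : ℕ).choose s), h1,
      Nat.sub_sub, Nat.add_comm (r : ℕ)]
  · have h1 : a.choose r * (a - r).choose s = 0 := by
      rw [mul_eq_zero]
      by_cases har : a < r
      · exact Or.inl (Nat.choose_eq_zero_of_lt har)
      · exact Or.inr (Nat.choose_eq_zero_of_lt (by omega))
    rw [← Nat.cast_mul, h1, Nat.cast_zero, zero_smul]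
    split_ifs with h
    · rw [map_smul, LinearMap.smul_apply, hD ⟨s + r, h⟩ a ha]
      simp only
      rw [Nat.choose_eq_zero_of_lt (show a < s + r by omega), Nat.cast_zero, zero_smul, smul_zero]
    · rw [map_zero, LinearMap.zero_apply]

theorem ActsAsHasse.zero_eq_one (h0 : 0 < p ^ n) : D ⟨0, h0⟩ = 1 := by
  refine hD.eq_of_apply_eq hB fun a ha => ?_
  rw [hD _ a ha, map_one]
  simp

end Hasse

/-! ### Bases of an ideal and of its associated order -/

section Bases

open WithZero

theorem stepWeight_add_le {N m : ℕ} (hm : m < N) {s a : ℕ} (hsa : s ≤ a) (ha : a < N) :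
    stepWeight (N - m) (a - s) + stepWeight (max m (N - m)) s ≤ stepWeight (N - m) a := by
  unfold stepWeight
  split_ifs <;> omega

/-- For each `s` some `a` reads off the coefficient at `D_s` without loss of integrality. -/
theorem exists_stepWeight_eq {p n m : ℕ} [hp : Fact p.Prime] (hm : m < p ^ n) (s : ℕ)
    (hs : s < p ^ n) : ∃ a, s ≤ a ∧ a < p ^ n ∧ ¬ p ∣ a.choose s ∧
      stepWeight (p ^ n - m) a =
        stepWeight (p ^ n - m) (a - s) + stepWeight (max m (p ^ n - m)) s := by
  by_cases h : s < p ^ n - m ∨ max m (p ^ n - m) ≤ s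
  · refine ⟨s, le_rfl, hs, by simpa using hp.out.one_lt.ne', ?_⟩
    unfold stepWeight
    split_ifs <;> omega
  · refine ⟨p ^ n - 1, by omega, by omega, not_dvd_choose_pow_sub_one hs, ?_⟩
    unfold stepWeight
    split_ifs <;> omega

theorem stepWeight_add_le_add {N k s r : ℕ} (hk : N ≤ 2 * k) (hsr : s + r < N) :
    stepWeight k s + stepWeight k r ≤ stepWeight k (s + r) := by
  unfold stepWeight
  split_ifs <;> omega

/-- An element of `K[G]` lies in the associated order of a lattice as soon as it maps a set of
generators into the lattice. -/
theorem mem_associatedOrder_span_iff {OK K L : Type*} [CommRing OK] [Field K] [Algebra OK K]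
    [Field L] [Algebra K L] [Algebra OK L] [IsScalarTower OK K L] {ι : Type*} {B' : ι → L}
    {P : Submodule OK L} (hP : P = Submodule.span OK (Set.range B'))
    {x : MonoidAlgebra K (L ≃ₐ[K] L)} :
    x ∈ associatedOrder OK K L P ↔ ∀ i, groupAlgebraAction K L x (B' i) ∈ P := by
  refine ⟨fun h i => h _ (hP ▸ Submodule.subset_span ⟨i, rfl⟩), fun h z hz => ?_⟩
  have h1 : P ≤ P.comap ((groupAlgebraAction K L x).restrictScalars OK) := by
    conv_lhs => rw [hP]
    rw [Submodule.span_le]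
    rintro _ ⟨i, rfl⟩
    exact h i
  exact h1 hz

instance isScalarTower_associatedOrder {OK K L : Type*} [CommRing OK] [Field K] [Algebra OK K]
    [Field L] [Algebra K L] [Algebra OK L] [IsScalarTower OK K L] (P : Submodule OK L) :
    IsScalarTower OK (associatedOrder OK K L P) P where
  smul_assoc c x z := Subtype.ext <| by
    rw [associatedOrder.coe_smul, SetLike.val_smul, SetLike.val_smul, associatedOrder.coe_smul,
      ← algebraMap_smul K c x.1, map_smul, LinearMap.smul_apply, algebraMap_smul]

variable {OK K OL L : Type*} [CommRing OK] [IsDomain OK] [IsDiscreteValuationRing OK]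
  [Field K] [Algebra OK K] [IsFractionRing OK K]
  [CommRing OL] [IsDomain OL] [IsDiscreteValuationRing OL]
  [Field L] [Algebra OL L] [IsFractionRing OL L]
  [Algebra K L] [Algebra OK L] [IsScalarTower OK K L] [FiniteDimensional K L]
  [Algebra OK OL] [IsScalarTower OK OL L] [IsIntegralClosure OL OK L]

/-- An `OK`-basis of `𝔓 ^ h` by multiples of the powers `y ^ a` of an element of valuation `-1`,
where `h = m + 1 + N * q`: the multiplier of `y ^ a` is `t ^ ⌈(h + a) / N⌉`. -/
theorem idealPow_eq_span {N m : ℕ} (hN : Module.finrank K L = N) (hm : m < N)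
    (htot : IsTotallyRamified OK K OL L) (hweak : IsWeaklyRamified OK K OL L)
    {t : OK} (ht : Irreducible t) {y : L} (hy : normVal OL L y = exp 1) {h q : ℤ}
    (hh : h = m + 1 + N * q) {B' : Module.Basis (Fin N) K L}
    (hB' : ∀ a, B' a = algebraMap OK K t ^ (q + 1 + stepWeight (N - m) a) • y ^ (a : ℕ)) :
    idealPow OK OL L h = Submodule.span OK (Set.range B') := by
  have hv : IsTotWeak K (normVal OL L) := isTotWeak_normVal htot hweak
  have hval : ∀ a, normVal OL L (B' a) =
      exp ((a : ℤ) - N * (q + 1 + stepWeight (N - m) a)) := fun a => by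
    rw [hB', Algebra.smul_def, map_mul, map_zpow₀, map_zpow₀, map_pow, hy,
      ← IsScalarTower.algebraMap_apply, normVal_base_irreducible htot ht, hN, ← exp_zsmul,
      ← exp_nsmul, ← exp_add]
    congr 1
    simp only [smul_eq_mul, nsmul_eq_mul]
    ring
  have hinj : ∀ a b : Fin N, (a : ℤ) - N * (q + 1 + stepWeight (N - m) a) ≡
      (b : ℤ) - N * (q + 1 + stepWeight (N - m) b) [ZMOD Module.finrank K L] → a = b := by
    intro a b hab
    rw [hN] at hab
    refine eq_of_modEq_of_lt a b ?_
    rw [Int.modEq_iff_dvd] at hab ⊢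
    obtain ⟨c, hc⟩ := hab
    exact ⟨c - (q + 1 + stepWeight (N - m) a) + (q + 1 + stepWeight (N - m) b), by
      linear_combination hc⟩
  ext x
  rw [Module.Basis.mem_span_iff_repr_mem, mem_idealPow_iff]
  simp_rw [← normVal_base_le_one_iff (OK := OK) htot]
  have hsum : ∑ a, B'.repr x a • B' a = x := B'.sum_repr x
  constructor
  · intro hx a
    have h1 := hv.le_apply_sum hval hinj (B'.repr x) a
    rw [hsum, Algebra.smul_def, map_mul, hval] at h1
    refine hv.base_le_of_lt (i := -h - (a - N * (q + 1 + stepWeight (N - m) a))) ?_ ?_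
    · have ha := a.2
      rw [hN, hh]
      unfold stepWeight
      split_ifs <;> push_cast <;> ring_nf <;> omega
    · rw [exp_sub, le_div_iff₀ exp_pos]
      exact h1.trans hx
  · intro hx
    rw [← hsum]
    refine Valuation.map_sum_le _ fun a _ => ?_
    rw [Algebra.smul_def, map_mul, hval]
    refine (mul_le_mul' (hx a) le_rfl).trans ?_
    rw [one_mul, exp_le_exp]
    have ha := a.2
    rw [hh]
    unfold stepWeight
    split_ifs <;> push_cast <;> ring_nf <;> omega

variable [IsGalois K L]

/-- Compatible bases of `𝔓 ^ h` and of its associated order. -/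
theorem exists_bases {p n m : ℕ} [Fact p.Prime] [CharP K p] (hN : Module.finrank K L = p ^ n)
    (hm : m < p ^ n) (htot : IsTotallyRamified OK K OL L) (hweak : IsWeaklyRamified OK K OL L)
    {t : OK} (ht : Irreducible t) {h q : ℤ} (hh : h = m + 1 + (p ^ n : ℕ) * q) :
    ∃ (E : Module.Basis (Fin (p ^ n)) OK (associatedOrder OK K L (idealPow OK OL L h)))
      (e : Module.Basis (Fin (p ^ n)) OK (idealPow OK OL L h)),
      IsDividedPowerBasis p (p ^ n) (stepWeight (max m (p ^ n - m))) t E ∧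
      IsHasseBasis p (p ^ n) (stepWeight (max m (p ^ n - m))) (stepWeight (p ^ n - m)) t E e := by
  have hv : IsTotWeak K (normVal OL L) := isTotWeak_normVal htot hweak
  have hpos : 0 < p ^ n := pow_pos (Fact.out : p.Prime).pos n
  have : CharP L p := charP_of_injective_algebraMap (algebraMap K L).injective p
  have : CharP OK p := (algebraMap OK K).charP (IsFractionRing.injective OK K) p
  obtain ⟨y, α, hy, hα, hyσ⟩ := hv.exists_translation hN
  obtain ⟨D, hD⟩ := exists_actsAsHasse hN hα hyσ
  have hpow : ∀ a : Fin (p ^ n), normVal OL L (y ^ (a : ℕ)) = exp (a : ℤ) := fun a => by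
    rw [map_pow, hy, ← exp_nsmul]; simp
  have hli := hv.linearIndependent hpow (by rw [hN]; exact eq_of_modEq_of_lt)
  let B := basisOfLinearIndependentOfCardEqFinrank' _ hli (by rw [Fintype.card_fin, hN])
  have hB : ∀ a, B a = y ^ (a : ℕ) := fun a => by simp [B]
  obtain ⟨b, hb⟩ := hD.exists_basis hB
  set w := stepWeight (max m (p ^ n - m)) with hw
  set d := stepWeight (p ^ n - m) with hd
  set T := algebraMap OK K t with hTdef
  have hT : T ≠ 0 := by simpa [hTdef] using ht.ne_zero
  have huB : ∀ a : Fin (p ^ n), IsUnit (T ^ (q + 1 + d a)) := fun a =>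
    (zpow_ne_zero _ hT).isUnit
  have hub : ∀ s : Fin (p ^ n), IsUnit ((T ^ w s)⁻¹) := fun s =>
    (inv_ne_zero (pow_ne_zero _ hT)).isUnit
  let B' := B.isUnitSMul huB
  let b' := b.isUnitSMul hub
  have hB' : ∀ a, B' a = T ^ (q + 1 + d a) • y ^ (a : ℕ) := fun a => by
    rw [← hB]; exact Module.Basis.isUnitSMul_apply huB a
  have hb' : ∀ s, b' s = (T ^ w s)⁻¹ • D s := fun s => by
    rw [← hb]; exact Module.Basis.isUnitSMul_apply hub s
  have hP : idealPow OK OL L h = Submodule.span OK (Set.range B') :=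
    idealPow_eq_span hN hm htot hweak ht hy hh hB'
  have hcast : ∀ i : ℕ, algebraMap OK K (i : OK) = (i : K) := fun i => map_natCast _ i
  have hact : ∀ s a : Fin (p ^ n), groupAlgebraAction K L (b' s) (B' a) = if s ≤ a then
      (((a : ℕ).choose s : OK) * t ^ (d a - d (a - s) - w s)) • B' ⟨a - s, by omega⟩ else 0 := by
    intro s a
    rw [hb', hB', map_smul, map_smul (groupAlgebraAction K L), LinearMap.smul_apply, hD s a a.2]
    split_ifs with hsa
    · have h1 : d (a - s) + w s ≤ d a := stepWeight_add_le hm hsa a.2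
      have h2 : (d a : ℤ) = d (a - s) + w s + (d a - d (a - s) - w s : ℕ) := by omega
      rw [hB', ← algebraMap_smul K (((a : ℕ).choose s : OK) * _), map_mul, map_pow,
        hcast, smul_smul, smul_smul, smul_smul]
      congr 1
      change T ^ (q + 1 + d a : ℤ) * (T ^ w s)⁻¹ * _ =
        _ * T ^ (d a - d (a - s) - w s) * T ^ (q + 1 + d (a - s) : ℤ)
      rw [h2, ← zpow_natCast T (w s), ← zpow_natCast T (d a - d (a - s) - w s), ← zpow_neg]
      have h3 : T ^ (q + 1 + (d (a - s) + w s + (d a - d (a - s) - w s : ℕ)) : ℤ) =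
          T ^ (w s : ℤ) * T ^ ((d a - d (a - s) - w s : ℕ) : ℤ) * T ^ (q + 1 + d (a - s) : ℤ) := by
        rw [← zpow_add₀ hT, ← zpow_add₀ hT]
        congr 1; ring
      rw [h3, zpow_neg]
      field_simp
    · have h1 : (a : ℕ) < s := not_le.1 hsa
      rw [Nat.choose_eq_zero_of_lt h1]
      simp
  have hA : Subalgebra.toSubmodule (associatedOrder OK K L (idealPow OK OL L h)) =
      Submodule.span OK (Set.range b') := by
    have hmem : ∀ s, b' s ∈ associatedOrder OK K L (idealPow OK OL L h) := fun s => by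
      rw [mem_associatedOrder_span_iff hP]
      intro a
      rw [hact, hP]
      split_ifs
      · exact Submodule.smul_mem _ _ (Submodule.subset_span ⟨_, rfl⟩)
      · exact Submodule.zero_mem _
    refine le_antisymm (fun x hx => ?_) (Submodule.span_le.2 ?_)
    · rw [Module.Basis.mem_span_iff_repr_mem]
      intro s
      -- The coordinate at `s` is read off from the action on a power `y ^ a` where the weights fit.
      obtain ⟨a, hsa, ha, hpa, hda⟩ := exists_stepWeight_eq hm s s.2
      have h1 : groupAlgebraAction K L x (B' ⟨a, ha⟩) ∈ Submodule.span OK (Set.range B') := by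
        rw [← hP]
        exact hx _ (hP ▸ Submodule.subset_span ⟨_, rfl⟩)
      rw [Module.Basis.mem_span_iff_repr_mem] at h1
      have h2 : B'.repr (groupAlgebraAction K L x (B' ⟨a, ha⟩)) ⟨a - s, by omega⟩ =
          b'.repr x s * ((a.choose s : ℕ) : K) := by
        have h3 : x = ∑ r, (b'.repr x r * (T ^ w r)⁻¹) • D r := by
          conv_lhs => rw [← b'.sum_repr x]
          exact Finset.sum_congr rfl fun r _ => by rw [hb', smul_smul]
        have h4 := hD.sum_apply hB (fun r => b'.repr x r * (T ^ w r)⁻¹) ha s hsa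
        rw [← h3] at h4
        have h5 : B'.repr (groupAlgebraAction K L x (y ^ a)) ⟨a - s, by omega⟩ =
            (T ^ (q + 1 + d (a - s) : ℤ))⁻¹ *
              B.repr (groupAlgebraAction K L x (y ^ a)) ⟨a - s, by omega⟩ := by
          rw [Module.Basis.repr_isUnitSMul, Units.smul_def, Units.val_inv_eq_inv_val,
            IsUnit.unit_spec, smul_eq_mul]
        rw [hB', map_smul, map_smul, Finsupp.smul_apply, h5, h4, smul_eq_mul]
        change T ^ (q + 1 + d a : ℤ) * _ = _
        rw [show (q + 1 + d a : ℤ) = w s + (q + 1 + d (a - s)) by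
            rw [← hd, ← hw] at hda; omega,
          zpow_add₀ hT, zpow_natCast]
        have h6 : T ^ (q + 1 + d (a - s) : ℤ) ≠ 0 := zpow_ne_zero _ hT
        have h7 : T ^ w s ≠ 0 := pow_ne_zero _ hT
        field_simp
      obtain ⟨c, hc⟩ := h1 ⟨a - s, by omega⟩
      obtain ⟨u, hu⟩ := (CharP.isUnit_natCast_iff (R := OK) (Fact.out : p.Prime)).2 hpa
      refine ⟨c * ↑u⁻¹, ?_⟩
      have h8 : algebraMap OK K (a.choose s : OK) * algebraMap OK K ↑u⁻¹ = 1 := by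
        rw [← hu, ← map_mul, Units.mul_inv, map_one]
      rw [map_mul, hc, h2, mul_assoc, ← hcast, h8, mul_one]
    · rintro _ ⟨s, rfl⟩
      exact hmem s
  let E : Module.Basis (Fin (p ^ n)) OK (associatedOrder OK K L (idealPow OK OL L h)) :=
    (b'.restrictScalars OK).map ((LinearEquiv.ofEq _ _ hA.symm).trans
      (Subalgebra.toSubmoduleEquiv _))
  let e : Module.Basis (Fin (p ^ n)) OK (idealPow OK OL L h) :=
    (B'.restrictScalars OK).map (LinearEquiv.ofEq _ _ hP.symm)
  have hE : ∀ s, ((E s : associatedOrder OK K L (idealPow OK OL L h)) :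
      MonoidAlgebra K (L ≃ₐ[K] L)) = b' s := fun s => b'.restrictScalars_apply OK s
  have he : ∀ a, ((e a : idealPow OK OL L h) : L) = B' a := fun a => B'.restrictScalars_apply OK a
  refine ⟨E, e, ⟨hpos, ?_, ?_, ?_⟩, ⟨?_, ?_⟩⟩
  · refine Subtype.ext ?_
    have h0 : w 0 = 0 := by
      rw [hw, stepWeight, if_neg (by omega)]
    rw [hE, hb', hD.zero_eq_one hB]
    change (T ^ w 0)⁻¹ • 1 = _
    rw [h0, pow_zero, inv_one, one_smul]
    rfl
  · intro s r
    refine Subtype.ext ?_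
    rw [MulMemClass.coe_mul, hE, hE, hb', hb', smul_mul_smul_comm, hD.mul hB]
    split_ifs with hsr
    · have h1 : w s + w r ≤ w (s + r) := stepWeight_add_le_add (by omega) hsr
      have h2 : T ^ w (s + r) = T ^ (w (s + r) - w s - w r) * (T ^ w s * T ^ w r) := by
        rw [← pow_add, ← pow_add]
        congr 1; omega
      have h3 : T ^ w s ≠ 0 := pow_ne_zero _ hT
      have h4 : T ^ w r ≠ 0 := pow_ne_zero _ hT
      have h5 : T ^ (w (s + r) - w s - w r) ≠ 0 := pow_ne_zero _ hT
      rw [SetLike.val_smul, hE, hb', ← algebraMap_smul K (((s + r : ℕ).choose s : OK) * _), map_mul,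
        map_pow, hcast, smul_smul, smul_smul]
      congr 1
      change _ = _ * T ^ (w (s + r) - w s - w r) * (T ^ w (s + r))⁻¹
      rw [h2]
      field_simp
    · rw [smul_zero]
      rfl
  · intro s r hsr _
    exact stepWeight_add_le_add (by omega) hsr
  · intro s a
    refine Subtype.ext ?_
    rw [associatedOrder.coe_smul, hE, he, hact]
    split_ifs
    · rw [Submodule.coe_smul, he]
    · rfl
  · intro c s hcs _
    have := stepWeight_add_le hm (show s ≤ c + s by omega) hcs
    rwa [Nat.add_sub_cancel] at this

end Bases

end WeakRam

theorem theorem4p4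
    (p n : ℕ) [Fact p.Prime]
    -- `K` is a local field of characteristic `p` with perfect residue field, `OK` its valuation ring
    (OK K : Type*) [CommRing OK] [IsDomain OK] [IsDiscreteValuationRing OK]
    [IsAdicComplete (IsLocalRing.maximalIdeal OK) OK]
    [PerfectField (IsLocalRing.ResidueField OK)]
    [Field K] [Algebra OK K] [IsFractionRing OK K] [CharP K p]
    -- `L` is a finite Galois extension of `K`, `OL` its valuation ring
    (OL L : Type*) [CommRing OL] [IsDomain OL] [IsDiscreteValuationRing OL]
    [Field L] [Algebra OL L] [IsFractionRing OL L]
    [Algebra K L] [Algebra OK L] [IsScalarTower OK K L] [FiniteDimensional K L] [IsGalois K L]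
    [Algebra OK OL] [IsScalarTower OK OL L] [IsIntegralClosure OL OK L]
    (hdeg : Module.finrank K L = p ^ n)
    (htot : WeakRam.IsTotallyRamified OK K OL L)
    (hweak : WeakRam.IsWeaklyRamified OK K OL L)
    (h : ℤ) :
    let P : Submodule OK L := WeakRam.idealPow OK OL L h
    let A : Subalgebra OK (MonoidAlgebra K (L ≃ₐ[K] L)) := WeakRam.associatedOrder OK K L P
    IsLocalRing A ∧
    (h ≡ 1 [ZMOD (p ^ n : ℕ)] → Module.Free A P ∧ WeakRam.embDim A = n + 1) ∧
    (¬ h ≡ 1 [ZMOD (p ^ n : ℕ)] →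
      ∀ h' : ℕ, (h' : ℤ) ≡ h [ZMOD (p ^ n : ℕ)] → 2 ≤ h' → h' ≤ p ^ n →
      ∀ m k : ℕ, m = h' - 1 → k = max m (p ^ n - m) →
        (Module.Free A P ↔ (1 : ℚ) + (p : ℚ) ^ n / 2 ≤ (h' : ℚ)) ∧
        (¬ Module.Free A P → ∃ d : ℕ, WeakRam.IsMinGenerators A P d ∧
          (d : ℤ) = 2 + (WeakRam.alphaStat p n m : ℤ) - (WeakRam.betaStat p n m : ℤ)) ∧
        (WeakRam.embDim A : ℤ) =
          (n : ℤ) + 2 + (WeakRam.alphaStat p n k : ℤ) - (WeakRam.gammaStat p n k : ℤ)) := by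
  intro P A
  have : CharP OK p := (algebraMap OK K).charP (IsFractionRing.injective OK K) p
  have hpos : 0 < p ^ n := pow_pos (Fact.out : p.Prime).pos n
  obtain ⟨t, ht⟩ := IsDiscreteValuationRing.exists_irreducible OK
  have htm : maximalIdeal OK = Ideal.span {t} := ht.maximalIdeal_eq
  have htm' : t ∈ maximalIdeal OK := htm ▸ Ideal.mem_span_singleton_self t
  refine ⟨?_, ?_, ?_⟩
  · have h1 : (h - 1) % (p ^ n : ℕ) = (((h - 1) % (p ^ n : ℕ)).toNat : ℕ) :=
      (Int.toNat_of_nonneg (Int.emod_nonneg _ (by exact_mod_cast hpos.ne'))).symm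
    have h2 : (h - 1) % (p ^ n : ℕ) < (p ^ n : ℕ) := Int.emod_lt_of_pos _ (by exact_mod_cast hpos)
    obtain ⟨E, e, hE, -⟩ := WeakRam.exists_bases hdeg
      (m := ((h - 1) % (p ^ n : ℕ)).toNat) (by omega) htot hweak ht
      (h := h) (q := (h - 1) / (p ^ n : ℕ)) (by
        rw [← h1]
        linear_combination -(Int.emod_add_mul_ediv (h - 1) (p ^ n : ℕ)))
    exact hE.isLocalRing
  · intro hh
    obtain ⟨q, hq⟩ := (Int.modEq_iff_dvd.1 hh.symm)
    obtain ⟨E, e, hE, he⟩ := WeakRam.exists_bases hdeg hpos htot hweak ht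
      (h := h) (q := q) (by push_cast at hq ⊢; linear_combination hq)
    rw [Nat.sub_zero, Nat.zero_max] at hE he
    refine ⟨(he.free_iff hE htm').2 ?_, ?_⟩
    · have := WeakRam.generatingExponents_of_le (p := p) hpos (Or.inl rfl)
      rw [Nat.sub_zero, Nat.zero_max] at this
      rw [this, Finset.card_singleton]
    · rw [hE.embDim_eq htm ht.ne_zero, WeakRam.card_indecomposables_self]
  · rintro hh h' hh' h2 hN m k rfl rfl
    obtain ⟨q, hq⟩ := Int.modEq_iff_dvd.1 hh'
    have hm : h' - 1 < p ^ n := by omega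
    have hm0 : h' - 1 ≠ 0 := by omega
    obtain ⟨E, e, hE, he⟩ := WeakRam.exists_bases hdeg hm htot hweak ht
      (h := h) (q := q) (by
        rw [Nat.cast_sub (by omega)]
        push_cast at hq ⊢
        linear_combination hq)
    have hfree : Module.Free A P ↔ p ^ n ≤ 2 * (h' - 1) := by
      rw [he.free_iff hE htm']
      refine ⟨fun h1 => ?_, fun h1 => ?_⟩
      · by_contra h3
        have := WeakRam.two_le_card_generatingExponents hm0 (not_le.1 h3)
        omega
      · rw [WeakRam.generatingExponents_of_le hm (Or.inr h1), Finset.card_singleton]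
    refine ⟨?_, fun hnf => ⟨_, he.isMinGenerators hE htm', ?_⟩, ?_⟩
    · rw [hfree, ← Nat.cast_le (α := ℚ), Nat.cast_mul, Nat.cast_sub (by omega)]
      push_cast
      constructor <;> intro h1 <;> linarith
    · exact WeakRam.card_generatingExponents hm0 (not_le.1 (hfree.not.1 hnf))
    · rw [hE.embDim_eq htm ht.ne_zero]
      have := WeakRam.card_indecomposables (p := p) (n := n) (k := max (h' - 1) (p ^ n - (h' - 1)))
        (by omega) (by omega)
      push_cast at this ⊢
      linear_combination this
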